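/- Let $\mathcal T$ be a nonzero triangulated category of finite type over a field (i.e. $\bigoplus_{n}\mathrm{Hom}(X,Y[n])$ is finite-dimensional for all $X,Y$) that has a split-generator. Let $\Lambda$ be a finitely generated free abelian group and $v:K(\mathcal T)\twoheadrightarrow\Lambda$ a surjective homomorphism. A stability condition $\sigma=(Z,\mathcal P)$ with respect to $(\Lambda,v)$ consists of a homomorphism $Z:\Lambda\to\mathbb C$ and full additive subcategories $\mathcal P(\phi)\subset\mathcal T$ $(\phi\in\mathbb R)$, closed under isomorphisms, such that: $Z(v(E))\in\mathbb R_{>0}e^{i\pi\phi}$ for $0\ne E\in\mathcal P(\phi)$; $\mathcal P(\phi+1)=\mathcal P(\phi)[1]$; $\mathrm{Hom}(E_1,E_2)=0$ for $E_i\in\mathcal P(\phi_i)$ with $\phi_1>\phi_2$; every $E\ne0$ has a Harder–Narasimhan filtration with nonzero factors $A_i\in\mathcal P(\phi_i)$, $\phi_1>\dots>\phi_p$; and, for some (equivalently every) norm on $\Lambda\otimes\mathbb R$, there is $C>0$ with $\|v(E)\|<C|Z(v(E))|$ for all $\phi$ and all $0\neq E\in\mathcal P(\phi)$. Put $\phi^+_\sigma(E)=\phi_1$,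 $\phi^-_\sigma(E)=\phi_p$, $m_\sigma(E)=\sum_i|Z(v(A_i))|$, and $$d_B(\sigma,\tau)=\sup_{E\neq0}\Bigl\{|\phi^+_\sigma(E)-\phi^+_\tau(E)|,\ |\phi^-_\sigma(E)-\phi^-_\tau(E)|,\ \Bigl|\log\tfrac{m_\sigma(E)}{m_\tau(E)}\Bigr|\Bigr\}\in[0,\infty].$$ Give the set $\mathrm{Stab}_\Lambda(\mathcal T)$ of stability conditions the topology induced by $d_B$, and let $\mathrm{Stab}^\dagger$ be one of its connected components. The group $\mathbb C$ acts on the right by $\sigma.\lambda=(e^{-i\pi\lambda}Z,\{\mathcal P(\phi+\mathrm{Re}\,\lambda)\})$; let $\bar d_B(\bar\sigma,\bar\tau)=\inf_{\lambda\in\mathbb C}d_B(\sigma,\tau.\lambda)$ on $\mathrm{Stab}^\dagger/\mathbb C$. The universal cover $\widetilde{\mathrm{GL}}{}_+(2,\mathbb R)$ is the group of pairs $g=(M,f)$, with $M\in\mathrm{GL}_+(2,\mathbb R)$ and $f:\mathbb R\to\mathbb R$ increasing with $f(\phi+1)=f(\phi)+1$, inducing the same map on $(\mathbb R^2\setminus0)/\mathbb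 R_{>0}=\mathbb R/2\mathbb Z$; it acts on the right by $\sigma.g=(M^{-1}\circ Z,\{\mathcal P(f(\phi))\})$. Let $F$ be an exact autoequivalence of $\mathcal T$ and $\alpha(F)\in\mathrm{Aut}_{\mathbb Z}(\Lambda)$ an automorphism with $v\circ K(F)=\alpha(F)\circ v$; put $F.\sigma=(Z\circ\alpha(F)^{-1},\{F(\mathcal P(\phi))\})$. Assume that $F$ is pseudo-Anosov: there are $\sigma_F\in\mathrm{Stab}^\dagger$, $r\in\mathbb R$ with $|r|>1$, and $g_F=(M,f)\in\widetilde{\mathrm{GL}}{}_+(2,\mathbb R)$ with $M=\mathrm{diag}(1/r,r)$ or $M=\mathrm{diag}(r,1/r)$, such that $F.\sigma_F=\sigma_F.g_F$. For objects $G,E$ let $\delta(G,E)$ be the least $p\ge1$ such that for some object $M$ the object $E\oplus M$ is an iterated extension of $p$ shifts $G[n_1],\dots,G[n_p]$. Then the categorical entropy $$h(F)=\lim_{n\to\infty}\tfrac1n\log\delta(G,F^nG)\in\mathbb R$$ exists for every split-generator $G$ and does not depend on $G$, and, with $\bar d_B(F)=\inf_{\bar\sigma\in\mathrm{Stab}^\dagger/\mathbb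 C}\bar d_B(\bar\sigma,F.\bar\sigma)$ the translation length of $F$, one has $$h(F)\ \ge\ \bar d_B(F)\ >\ 0.$$ -/

import Mathlib

open CategoryTheory CategoryTheory.Limits CategoryTheory.Pretriangulated Filter Topology
open scoped ENNReal TensorProduct ZeroObject

universe w u

namespace StabCond

noncomputable section

/-! ### Finite type, Grothendieck group, split-generators -/

section Basics

variable (T : Type u) [Category.{w} T] [HasZeroObject T] [HasShift T ℤ] [Preadditive T]
  [∀ n : ℤ, (shiftFunctor T n).Additive]

/-- `T` is of finite type over `k`: for all `X`, `Y` the total space `⨁ₙ Hom(X, Y[n])` is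
finite-dimensional over `k`. -/
def IsFiniteType (k : Type*) [Field k] [Linear k T] : Prop :=
  ∀ X Y : T, Module.Finite k (DirectSum ℤ fun n : ℤ => (X ⟶ Y⟦n⟧))

variable [Pretriangulated T]

/-- The relations `[X₂] = [X₁] + [X₃]` for the exact triangles `X₁ ⟶ X₂ ⟶ X₃ ⟶ X₁[1]`. -/
def K0Relations : AddSubgroup (FreeAbelianGroup T) :=
  AddSubgroup.closure {x | ∃ t : Triangle T, t ∈ distTriang T ∧
    x = FreeAbelianGroup.of t.obj₂ - FreeAbelianGroup.of t.obj₁ - FreeAbelianGroup.of t.obj₃}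

/-- The Grothendieck group of a triangulated category. -/
def K0 : Type u := FreeAbelianGroup T ⧸ K0Relations T

instance : AddCommGroup (K0 T) :=
  inferInstanceAs (AddCommGroup (FreeAbelianGroup T ⧸ K0Relations T))

variable {T}

/-- The class of an object in the Grothendieck group. -/
def K0.mk (X : T) : K0 T := QuotientAddGroup.mk (s := K0Relations T) (FreeAbelianGroup.of X)

lemma K0.mk_triangle (t : Triangle T) (ht : t ∈ distTriang T) :
    K0.mk t.obj₂ = K0.mk t.obj₁ + K0.mk t.obj₃ := by
  have h : FreeAbelianGroup.of t.obj₂ - FreeAbelianGroup.of t.obj₁ - FreeAbelianGroup.of t.obj₃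
      ∈ K0Relations T := AddSubgroup.subset_closure ⟨t, ht, rfl⟩
  have h2 := (QuotientAddGroup.eq_zero_iff _).2 h
  have h3 : K0.mk t.obj₂ - K0.mk t.obj₁ - K0.mk t.obj₃ = 0 := h2
  rw [sub_sub, sub_eq_zero] at h3
  exact h3

lemma K0.mk_iso {X Y : T} (e : X ≅ Y) : K0.mk X = K0.mk Y := by
  have h0 : K0.mk (0 : T) = 0 := by
    have h := K0.mk_triangle _ (contractible_distinguished (0 : T))
    simpa using h
  have h := K0.mk_triangle (Triangle.mk e.hom (0 : Y ⟶ 0) 0)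
    (isomorphic_distinguished _ (contractible_distinguished X) _
      (Triangle.isoMk _ _ (Iso.refl _) e.symm (Iso.refl _)
        (by simp : e.hom ≫ e.inv = 𝟙 X ≫ 𝟙 X)
        (by simp : (0 : Y ⟶ 0) ≫ 𝟙 (0 : T) = e.inv ≫ (0 : X ⟶ 0))
        (by simp : (0 : (0 : T) ⟶ X⟦(1 : ℤ)⟧) ≫ (𝟙 X)⟦(1 : ℤ)⟧' =
          𝟙 (0 : T) ≫ (0 : (0 : T) ⟶ X⟦(1 : ℤ)⟧))))
  simp only [Triangle.mk_obj₁, Triangle.mk_obj₂, Triangle.mk_obj₃, h0, add_zero] at h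
  exact h.symm

/-- The endomorphism `K(F)` of the Grothendieck group induced by an exact functor, `[X] ↦ [F X]`. -/
def K0.map (F : T ⥤ T) [F.CommShift ℤ] [F.IsTriangulated] : K0 T →+ K0 T :=
  QuotientAddGroup.lift (K0Relations T) (FreeAbelianGroup.lift fun X => K0.mk (F.obj X)) (by
    rw [K0Relations, AddSubgroup.closure_le]
    rintro _ ⟨t, ht, rfl⟩
    have h := K0.mk_triangle _ (F.map_distinguished t ht)
    simp only [Functor.mapTriangle_obj, Triangle.mk_obj₁, Triangle.mk_obj₂,
      Triangle.mk_obj₃] at h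
    simp [h])

@[simp]
lemma K0.map_mk (F : T ⥤ T) [F.CommShift ℤ] [F.IsTriangulated] (X : T) :
    K0.map F (K0.mk X) = K0.mk (F.obj X) :=
  FreeAbelianGroup.lift_apply_of (fun X => K0.mk (F.obj X)) X

/-- `G` is a split-generator: the smallest full triangulated subcategory containing `G` and
closed under isomorphisms and direct summands is the whole category. -/
def IsSplitGenerator (G : T) : Prop :=
  (ObjectProperty.singleton G).IsClassicalTriangulatedGenerator

/-- `E` is an iterated extension of the objects `A 0, …, A (p - 1)`: there are objects
`0 = X 0, X 1, …, X p ≅ E` and exact triangles `X i ⟶ X (i + 1) ⟶ A i ⟶ (X i)[1]`. -/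
def IsTower {p : ℕ} (A : Fin p → T) (E : T) : Prop :=
  ∃ X : Fin (p + 1) → T, IsZero (X 0) ∧ Nonempty (X (Fin.last p) ≅ E) ∧
    ∀ i : Fin p, ∃ (f : X i.castSucc ⟶ X i.succ) (g : X i.succ ⟶ A i)
      (h : A i ⟶ (X i.castSucc)⟦(1 : ℤ)⟧), Triangle.mk f g h ∈ distTriang T

lemma IsTower.map {p : ℕ} {A : Fin p → T} {E : T} (h : IsTower A E)
    (F : T ⥤ T) [F.CommShift ℤ] [F.IsTriangulated] :
    IsTower (fun i => F.obj (A i)) (F.obj E) := by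
  obtain ⟨X, h0, ⟨e⟩, ht⟩ := h
  refine ⟨fun i => F.obj (X i), F.map_isZero h0, ⟨F.mapIso e⟩, fun i => ?_⟩
  obtain ⟨f, g, k, hT⟩ := ht i
  exact ⟨F.map f, F.map g, F.map k ≫ (F.commShiftIso (1 : ℤ)).hom.app _,
    F.map_distinguished _ hT⟩

lemma IsTower.of_iso {p : ℕ} {A : Fin p → T} {E E' : T} (h : IsTower A E) (e : E ≅ E') :
    IsTower A E' := by
  obtain ⟨X, h0, ⟨e'⟩, ht⟩ := h
  exact ⟨X, h0, ⟨e' ≪≫ e⟩, ht⟩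

end Basics

/-! ### Stability conditions -/

section Stability

variable {T : Type u} [Category.{w} T] [HasZeroObject T] [HasShift T ℤ] [Preadditive T]
  [∀ n : ℤ, (shiftFunctor T n).Additive] [Pretriangulated T]

/-- A Harder--Narasimhan filtration of `E` with respect to `P`, with factors
`factor 0, …, factor len` (nonzero) of strictly decreasing phases. -/
structure HNFiltration (P : ℝ → ObjectProperty T) (E : T) where
  len : ℕ
  phase : Fin (len + 1) → ℝ
  factor : Fin (len + 1) → T
  strictAnti : StrictAnti phase
  mem : ∀ i, P (phase i) (factor i)
  nonzero : ∀ i, ¬ IsZero (factor i)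
  tower : IsTower factor E

/-- The support property of a central charge `Z` and a slicing `P`. All norms on the
finite-dimensional space `Λ ⊗ ℝ` being equivalent, it does not depend on the norm; a norm is a
seminorm vanishing at zero only. -/
def SupportProperty {Λ : Type*} [AddCommGroup Λ] (v : K0 T →+ Λ) (Z : Λ →+ ℂ)
    (P : ℝ → ObjectProperty T) : Prop :=
  ∃ N : Seminorm ℝ (ℝ ⊗[ℤ] Λ), (∀ x, N x = 0 → x = 0) ∧
    ∃ C : ℝ, 0 < C ∧ ∀ (φ : ℝ) (E : T), P φ E → ¬ IsZero E →
      N ((1 : ℝ) ⊗ₜ[ℤ] v (K0.mk E)) < C * ‖Z (v (K0.mk E))‖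

/-- A Bridgeland stability condition `(Z, P)` on `T` with respect to `v : K(T) → Λ`. -/
@[ext]
structure StabilityCondition {Λ : Type*} [AddCommGroup Λ] (v : K0 T →+ Λ) where
  /-- the central charge -/
  Z : Λ →+ ℂ
  /-- the slicing; each `P φ` is a full additive subcategory (closed under isomorphisms) -/
  P : ℝ → ObjectProperty T
  zero_mem : ∀ φ (X : T), IsZero X → P φ X
  iso_mem : ∀ φ (X Y : T), (X ≅ Y) → P φ X → P φ Y
  biprod_mem : ∀ φ (X Y : T), P φ X → P φ Y → P φ (X ⊞ Y)
  compat : ∀ φ (E : T), P φ E → ¬ IsZero E →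
    ∃ m : ℝ, 0 < m ∧ Z (v (K0.mk E)) = m * Complex.exp (Complex.I * Real.pi * φ)
  shift : ∀ φ (X : T), P φ X ↔ P (φ + 1) (X⟦(1 : ℤ)⟧)
  hom_zero : ∀ φ₁ φ₂ (E₁ E₂ : T), φ₂ < φ₁ → P φ₁ E₁ → P φ₂ E₂ → ∀ f : E₁ ⟶ E₂, f = 0
  hn : ∀ E : T, ¬ IsZero E → Nonempty (HNFiltration P E)
  support : SupportProperty v Z P

variable {Λ : Type*} [AddCommGroup Λ] {v : K0 T →+ Λ}

namespace StabilityCondition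

/-- A chosen Harder--Narasimhan filtration (it is unique up to isomorphism). -/
def hnf (σ : StabilityCondition v) (E : T) (hE : ¬ IsZero E) : HNFiltration σ.P E :=
  (σ.hn E hE).some

/-- `φ⁺(E)`, the phase of the first semistable factor. -/
def phiPlus (σ : StabilityCondition v) (E : T) (hE : ¬ IsZero E) : ℝ :=
  (σ.hnf E hE).phase 0

/-- `φ⁻(E)`, the phase of the last semistable factor. -/
def phiMinus (σ : StabilityCondition v) (E : T) (hE : ¬ IsZero E) : ℝ :=
  (σ.hnf E hE).phase (Fin.last _)

/-- The mass of a nonzero object: the sum of `|Z(Aᵢ)|` over its semistable factors `Aᵢ`. -/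
def mass (σ : StabilityCondition v) (E : T) (hE : ¬ IsZero E) : ℝ :=
  ∑ i, ‖σ.Z (v (K0.mk ((σ.hnf E hE).factor i)))‖

/-- Bridgeland's generalized metric, with values in `[0, ∞]`. -/
def dB (σ τ : StabilityCondition v) : ℝ≥0∞ :=
  ⨆ (E : T) (hE : ¬ IsZero E),
    max (max (ENNReal.ofReal |σ.phiPlus E hE - τ.phiPlus E hE|)
        (ENNReal.ofReal |σ.phiMinus E hE - τ.phiMinus E hE|))
      (ENNReal.ofReal |Real.log (σ.mass E hE / τ.mass E hE)|)

/-- The topology of the space of stability conditions, induced by `dB`: a set is open if it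
contains, with each point, a ball around it. -/
instance : TopologicalSpace (StabilityCondition v) where
  IsOpen U := ∀ σ ∈ U, ∃ ε : ℝ, 0 < ε ∧ ∀ τ, dB σ τ < ENNReal.ofReal ε → τ ∈ U
  isOpen_univ := fun _ _ => ⟨1, one_pos, fun _ _ => trivial⟩
  isOpen_inter := by
    intro s t hs ht σ hσ
    obtain ⟨ε, hε, h⟩ := hs σ hσ.1
    obtain ⟨ε', hε', h'⟩ := ht σ hσ.2
    refine ⟨min ε ε', lt_min hε hε', fun τ hτ => ⟨h τ (hτ.trans_le ?_), h' τ (hτ.trans_le ?_)⟩⟩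
    · exact ENNReal.ofReal_le_ofReal (min_le_left _ _)
    · exact ENNReal.ofReal_le_ofReal (min_le_right _ _)
  isOpen_sUnion := by
    intro S hS σ ⟨U, hU, hσ⟩
    obtain ⟨ε, hε, h⟩ := hS U hU σ hσ
    exact ⟨ε, hε, fun τ hτ => ⟨U, hU, h τ hτ⟩⟩

end StabilityCondition

end Stability

/-! ### The action of autoequivalences -/

section AutAction

variable {T : Type u} [Category.{w} T] [HasZeroObject T] [HasShift T ℤ] [Preadditive T]
  [∀ n : ℤ, (shiftFunctor T n).Additive] [Pretriangulated T]
  {Λ : Type*} [AddCommGroup Λ] {v : K0 T →+ Λ}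

/-- The exact autoequivalence `F` induces the automorphism `α` of `Λ`: `v ∘ K(F) = α ∘ v`. -/
def InducesOn (v : K0 T →+ Λ) (F : T ≌ T) [F.functor.CommShift ℤ] [F.functor.IsTriangulated]
    (α : Λ ≃+ Λ) : Prop :=
  ∀ x : K0 T, v (K0.map F.functor x) = α (v x)

namespace StabilityCondition

/-- The left action `F.σ = (Z ∘ α(F)⁻¹, {F(P(φ))})`. -/
def autAct (F : T ≌ T) [F.functor.CommShift ℤ] [F.functor.IsTriangulated]
    (α : Λ ≃+ Λ) (hα : InducesOn v F α) (σ : StabilityCondition v) : StabilityCondition v where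
  Z := σ.Z.comp α.symm.toAddMonoidHom
  P φ := (σ.P φ).map F.functor
  zero_mem φ X hX := ⟨0, σ.zero_mem φ _ (isZero_zero T),
    ⟨(F.functor.map_isZero (isZero_zero T)).iso hX⟩⟩
  iso_mem φ X Y e := fun ⟨A, hA, ⟨i⟩⟩ => ⟨A, hA, ⟨i ≪≫ e⟩⟩
  biprod_mem φ X Y := fun ⟨A, hA, ⟨i⟩⟩ ⟨B, hB, ⟨j⟩⟩ => by
    have : PreservesBinaryBiproducts F.functor := preservesBinaryBiproducts_of_preservesBiproducts _
    exact ⟨A ⊞ B, σ.biprod_mem φ A B hA hB,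
      ⟨F.functor.mapBiprod A B ≪≫ biprod.mapIso i j⟩⟩
  compat := by
    rintro φ E ⟨A, hA, ⟨i⟩⟩ hE
    have hA0 : ¬ IsZero A := fun h => hE ((F.functor.map_isZero h).of_iso i.symm)
    obtain ⟨m, hm, h⟩ := σ.compat φ A hA hA0
    refine ⟨m, hm, ?_⟩
    rw [← h, ← K0.mk_iso i, ← K0.map_mk F.functor, hα]
    simp
  shift := by
    intro φ X
    constructor
    · rintro ⟨A, hA, ⟨i⟩⟩
      exact ⟨A⟦(1 : ℤ)⟧, (σ.shift φ A).1 hA,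
        ⟨(F.functor.commShiftIso (1 : ℤ)).app A ≪≫ (shiftFunctor T (1 : ℤ)).mapIso i⟩⟩
    · rintro ⟨A, hA, ⟨i⟩⟩
      let e : (A⟦(-1 : ℤ)⟧)⟦(1 : ℤ)⟧ ≅ A := (shiftFunctorCompIsoId T (-1 : ℤ) 1 (by simp)).app A
      refine ⟨A⟦(-1 : ℤ)⟧, (σ.shift φ _).2 (σ.iso_mem _ _ _ e.symm hA), ⟨?_⟩⟩
      exact (shiftFunctor T (1 : ℤ)).preimageIso
        (((F.functor.commShiftIso (1 : ℤ)).app _).symm ≪≫ F.functor.mapIso e ≪≫ i)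
  hom_zero := by
    rintro φ₁ φ₂ E₁ E₂ h ⟨A, hA, ⟨i⟩⟩ ⟨B, hB, ⟨j⟩⟩ f
    have h0 := σ.hom_zero φ₁ φ₂ A B h hA hB (F.functor.preimage (i.hom ≫ f ≫ j.inv))
    have h1 := congrArg F.functor.map h0
    rw [F.functor.map_preimage, F.functor.map_zero] at h1
    have h2 : f = i.inv ≫ (i.hom ≫ f ≫ j.inv) ≫ j.hom := by simp
    rw [h2, h1]; simp
  hn := by
    intro E hE
    have hE' : ¬ IsZero (F.inverse.obj E) := fun h =>
      hE ((F.functor.map_isZero h).of_iso (F.counitIso.app E).symm)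
    obtain ⟨H⟩ := σ.hn _ hE'
    refine ⟨⟨H.len, H.phase, fun i => F.functor.obj (H.factor i), H.strictAnti,
      fun i => ⟨_, H.mem i, ⟨Iso.refl _⟩⟩, fun i h => H.nonzero i ?_,
      (H.tower.map F.functor).of_iso (F.counitIso.app E)⟩⟩
    rw [IsZero.iff_id_eq_zero] at h ⊢
    apply F.functor.map_injective
    simpa using h
  support := by
    obtain ⟨N, hN, C, hC, h⟩ := σ.support
    let L : ℝ ⊗[ℤ] Λ →ₗ[ℝ] ℝ ⊗[ℤ] Λ :=
      LinearMap.baseChange ℝ α.symm.toAddMonoidHom.toIntLinearMap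
    let L' : ℝ ⊗[ℤ] Λ →ₗ[ℝ] ℝ ⊗[ℤ] Λ :=
      LinearMap.baseChange ℝ α.toAddMonoidHom.toIntLinearMap
    have hL : ∀ x, L' (L x) = x := by
      intro x
      induction x using TensorProduct.induction_on with
      | zero => simp
      | tmul a b => simp [L, L']
      | add a b ha hb => rw [map_add, map_add, ha, hb]
    refine ⟨N.comp L, fun x hx => ?_, C, hC, ?_⟩
    · have := hN _ hx
      rw [← hL x, this, map_zero]
    · rintro φ E ⟨A, hA, ⟨i⟩⟩ hE
      have hA0 : ¬ IsZero A := fun h => hE ((F.functor.map_isZero h).of_iso i.symm)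
      have := h φ A hA hA0
      rw [← K0.mk_iso i, ← K0.map_mk F.functor, hα]
      simpa [L] using this

end StabilityCondition

end AutAction

/-! ### The universal cover of `GL⁺(2, ℝ)` and its action; the action of `ℂ` -/

/-- The `ℝ`-linear endomorphism of `ℂ = ℝ²` given by a real `2 × 2` matrix (acting on column
vectors). -/
def matAct (M : Matrix (Fin 2) (Fin 2) ℝ) : ℂ →ₗ[ℝ] ℂ :=
  Matrix.toLin Complex.basisOneI Complex.basisOneI M

/-- The universal cover of `GL⁺(2, ℝ)`, as the set of pairs `(M, f)` with `f : ℝ → ℝ` increasing,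
`f(φ + 1) = f(φ) + 1`, and `M ∈ GL⁺(2, ℝ)`, that induce the same map on
`(ℝ² ∖ {0}) / ℝ_{>0} = ℝ / 2ℤ`. The covering map is `(M, f) ↦ M`. -/
structure GLTilde where
  M : Matrix (Fin 2) (Fin 2) ℝ
  det_pos : 0 < M.det
  f : ℝ → ℝ
  strictMono : StrictMono f
  map_add_one : ∀ φ, f (φ + 1) = f φ + 1
  compat : ∀ φ : ℝ, ∃ c : ℝ, 0 < c ∧
    matAct M (Complex.exp (Complex.I * Real.pi * φ)) =
      c * Complex.exp (Complex.I * Real.pi * f φ)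

namespace GLTilde

lemma matAct_inv_left (g : GLTilde) (z : ℂ) : matAct g.M⁻¹ (matAct g.M z) = z := by
  have hu : IsUnit g.M.det := g.det_pos.ne'.isUnit
  rw [matAct, matAct, ← LinearMap.comp_apply,
    ← Matrix.toLin_mul Complex.basisOneI Complex.basisOneI Complex.basisOneI,
    Matrix.nonsing_inv_mul _ hu, Matrix.toLin_one, LinearMap.id_apply]

lemma matAct_inv_right (g : GLTilde) (z : ℂ) : matAct g.M (matAct g.M⁻¹ z) = z := by
  have hu : IsUnit g.M.det := g.det_pos.ne'.isUnit
  rw [matAct, matAct, ← LinearMap.comp_apply,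
    ← Matrix.toLin_mul Complex.basisOneI Complex.basisOneI Complex.basisOneI,
    Matrix.mul_nonsing_inv _ hu, Matrix.toLin_one, LinearMap.id_apply]

lemma map_add_int (g : GLTilde) (φ : ℝ) (n : ℤ) : g.f (φ + n) = g.f φ + n := by
  induction n using Int.induction_on with
  | zero => simp
  | succ n ih =>
    have := g.map_add_one (φ + (n : ℤ))
    push_cast at *
    rw [← add_assoc, this, ih]; ring
  | pred n ih =>
    have := g.map_add_one (φ + ((-(n : ℤ) - 1 : ℤ) : ℝ))
    push_cast at *
    rw [show φ + (-(n : ℝ) - 1) + 1 = φ + -n by ring, ih] at this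
    linarith

lemma surjective (g : GLTilde) : Function.Surjective g.f := by
  intro t
  set z := matAct g.M⁻¹ (Complex.exp (Complex.I * Real.pi * t)) with hz
  have hz0 : z ≠ 0 := by
    intro h
    have h1 := g.matAct_inv_right (Complex.exp (Complex.I * Real.pi * t))
    rw [← hz, h, map_zero] at h1
    exact Complex.exp_ne_zero _ h1.symm
  obtain ⟨c, hc, h⟩ := g.compat (z.arg / Real.pi)
  have harg : Complex.I * Real.pi * ((z.arg / Real.pi : ℝ) : ℂ) = z.arg * Complex.I := by
    have : (Real.pi : ℂ) ≠ 0 := by exact_mod_cast Real.pi_ne_zero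
    push_cast
    field_simp
  rw [harg] at h
  have h1 : matAct g.M z = ‖z‖ • (matAct g.M (Complex.exp (z.arg * Complex.I))) := by
    rw [← map_smul, Complex.real_smul, Complex.norm_mul_exp_arg_mul_I]
  rw [hz, g.matAct_inv_right, ← hz, h, Complex.real_smul] at h1
  have hn : ∀ x : ℝ, ‖Complex.exp (Complex.I * Real.pi * x)‖ = 1 := by
    intro x
    rw [show Complex.I * Real.pi * x = ((Real.pi * x : ℝ) : ℂ) * Complex.I by push_cast; ring]
    exact Complex.norm_exp_ofReal_mul_I _
  have h2 : ‖z‖ * c = 1 := by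
    have := congrArg norm h1
    rw [hn, norm_mul, norm_mul, hn, Complex.norm_real, Complex.norm_real, norm_norm,
      Real.norm_of_nonneg hc.le, mul_one] at this
    exact this.symm
  rw [← mul_assoc, ← Complex.ofReal_mul, h2, Complex.ofReal_one, one_mul,
    Complex.exp_eq_exp_iff_exists_int] at h1
  obtain ⟨n, hn⟩ := h1
  refine ⟨z.arg / Real.pi + ((2 * n : ℤ) : ℝ), ?_⟩
  rw [g.map_add_int]
  have h3 : (Complex.I * Real.pi) * (t : ℂ) =
      (Complex.I * Real.pi) * ((g.f (z.arg / Real.pi) + ((2 * n : ℤ) : ℝ) : ℝ) : ℂ) := by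
    rw [hn]; push_cast; ring
  have h4 : (Complex.I * Real.pi : ℂ) ≠ 0 :=
    mul_ne_zero Complex.I_ne_zero (by exact_mod_cast Real.pi_ne_zero)
  exact_mod_cast (mul_left_cancel₀ h4 h3).symm

end GLTilde

section RightActions

variable {T : Type u} [Category.{w} T] [HasZeroObject T] [HasShift T ℤ] [Preadditive T]
  [∀ n : ℤ, (shiftFunctor T n).Additive] [Pretriangulated T]
  {Λ : Type*} [AddCommGroup Λ] {v : K0 T →+ Λ}

namespace StabilityCondition

/-- The right action `σ.g = (M⁻¹ ∘ Z, {P(f(φ))})` of `g = (M, f)`. -/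
def glAct (σ : StabilityCondition v) (g : GLTilde) : StabilityCondition v where
  Z := (matAct g.M⁻¹).toAddMonoidHom.comp σ.Z
  P φ := σ.P (g.f φ)
  zero_mem φ := σ.zero_mem _
  iso_mem φ := σ.iso_mem _
  biprod_mem φ := σ.biprod_mem _
  compat := by
    intro φ E hE h0
    obtain ⟨m, hm, h⟩ := σ.compat _ E hE h0
    obtain ⟨c, hc, h'⟩ := g.compat φ
    refine ⟨m / c, div_pos hm hc, ?_⟩
    have hc' : (c : ℂ) ≠ 0 := by exact_mod_cast hc.ne'
    have h1 : σ.Z (v (K0.mk E)) =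
        (m / c) • matAct g.M (Complex.exp (Complex.I * Real.pi * φ)) := by
      rw [h, h', Complex.real_smul]; push_cast; field_simp
    change matAct g.M⁻¹ (σ.Z (v (K0.mk E))) = _
    rw [h1, map_smul, g.matAct_inv_left, Complex.real_smul]
  shift := by
    intro φ X
    rw [g.map_add_one]
    exact σ.shift _ X
  hom_zero φ₁ φ₂ E₁ E₂ h := σ.hom_zero _ _ E₁ E₂ (g.strictMono h)
  hn := by
    intro E hE
    obtain ⟨H⟩ := σ.hn E hE
    choose s hs using fun i => g.surjective (H.phase i)
    refine ⟨⟨H.len, s, H.factor, fun i j hij => ?_, fun i => ?_, H.nonzero, H.tower⟩⟩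
    · rw [← g.strictMono.lt_iff_lt, hs, hs]
      exact H.strictAnti hij
    · rw [hs]; exact H.mem i
  support := by
    obtain ⟨N, hN, C, hC, h⟩ := σ.support
    let L : ℂ →L[ℝ] ℂ := LinearMap.toContinuousLinearMap (matAct g.M)
    refine ⟨N, hN, C * (‖L‖ + 1), by positivity, fun φ E hE h0 => (h _ E hE h0).trans_le ?_⟩
    change _ ≤ C * (‖L‖ + 1) * ‖matAct g.M⁻¹ (σ.Z (v (K0.mk E)))‖
    have h1 := L.le_opNorm (matAct g.M⁻¹ (σ.Z (v (K0.mk E))))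
    have h2 : L (matAct g.M⁻¹ (σ.Z (v (K0.mk E)))) = σ.Z (v (K0.mk E)) :=
      g.matAct_inv_right _
    rw [h2] at h1
    rw [mul_assoc]
    gcongr
    nlinarith [norm_nonneg (matAct g.M⁻¹ (σ.Z (v (K0.mk E))))]

/-- The right action `σ.z = (exp(-iπz) Z, {P(φ + Re z)})` of `z ∈ ℂ`. -/
def cAct (σ : StabilityCondition v) (z : ℂ) : StabilityCondition v where
  Z := (AddMonoidHom.mulLeft (Complex.exp (-(Complex.I * Real.pi * z)))).comp σ.Z
  P φ := σ.P (φ + z.re)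
  zero_mem φ := σ.zero_mem _
  iso_mem φ := σ.iso_mem _
  biprod_mem φ := σ.biprod_mem _
  compat := by
    intro φ E hE h0
    obtain ⟨m, hm, h⟩ := σ.compat _ E hE h0
    refine ⟨m * Real.exp (Real.pi * z.im), by positivity, ?_⟩
    change Complex.exp (-(Complex.I * Real.pi * z)) * σ.Z (v (K0.mk E)) = _
    rw [h]
    push_cast
    rw [mul_left_comm, ← Complex.exp_add, mul_assoc (m : ℂ), ← Complex.exp_add]
    congr 2
    nth_rewrite 1 [← Complex.re_add_im z]
    linear_combination (-(Real.pi : ℂ) * z.im) * Complex.I_mul_I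
  shift := by
    intro φ X
    rw [show φ + 1 + z.re = φ + z.re + 1 by ring]
    exact σ.shift _ X
  hom_zero φ₁ φ₂ E₁ E₂ h := σ.hom_zero _ _ E₁ E₂ (by linarith)
  hn := by
    intro E hE
    obtain ⟨H⟩ := σ.hn E hE
    refine ⟨⟨H.len, fun i => H.phase i - z.re, H.factor, fun i j hij => ?_, fun i => ?_,
      H.nonzero, H.tower⟩⟩
    · exact sub_lt_sub_right (H.strictAnti hij) _
    · simpa using H.mem i
  support := by
    obtain ⟨N, hN, C, hC, h⟩ := σ.support
    have hpos : 0 < ‖Complex.exp (-(Complex.I * Real.pi * z))‖ :=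
      norm_pos_iff.2 (Complex.exp_ne_zero _)
    refine ⟨N, hN, C / ‖Complex.exp (-(Complex.I * Real.pi * z))‖, by positivity,
      fun φ E hE h0 => (h _ E hE h0).trans_le (le_of_eq ?_)⟩
    change _ = _ * ‖Complex.exp (-(Complex.I * Real.pi * z)) * σ.Z (v (K0.mk E))‖
    rw [norm_mul]
    field_simp

/-- The quotient metric by the action of `ℂ`, on representatives of two `ℂ`-orbits. -/
def dBbar (σ τ : StabilityCondition v) : ℝ≥0∞ := ⨅ z : ℂ, dB σ (τ.cAct z)

end StabilityCondition

/-- The translation length of `F` on `(S / ℂ, dBbar)`, for a component `S` of the space of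
stability conditions; the infimum over orbits is taken over representatives. -/
def translationLength (F : T ≌ T) [F.functor.CommShift ℤ] [F.functor.IsTriangulated]
    (α : Λ ≃+ Λ) (hα : InducesOn v F α) (S : Set (StabilityCondition v)) : ℝ≥0∞ :=
  ⨅ σ ∈ S, StabilityCondition.dBbar σ (σ.autAct F α hα)

/-- `F` is pseudo-Anosov with respect to the component `S`. -/
def IsPseudoAnosov (F : T ≌ T) [F.functor.CommShift ℤ] [F.functor.IsTriangulated]
    (α : Λ ≃+ Λ) (hα : InducesOn v F α) (S : Set (StabilityCondition v)) : Prop :=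
  ∃ σ ∈ S, ∃ (g : GLTilde) (r : ℝ), 1 < |r| ∧
    (g.M = !![1 / r, 0; 0, r] ∨ g.M = !![r, 0; 0, 1 / r]) ∧
    σ.autAct F α hα = σ.glAct g

end RightActions

/-! ### Entropy -/

section Entropy

variable {T : Type u} [Category.{w} T] [HasZeroObject T] [HasShift T ℤ] [Preadditive T]
  [∀ n : ℤ, (shiftFunctor T n).Additive] [Pretriangulated T]

/-- The complexity `δ(G, E)`: the least `p ≥ 1` such that some `E ⊕ M` is an iterated extension
of `p` shifts of `G`. -/
def complexity (G E : T) : ℕ :=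
  sInf {p : ℕ | 0 < p ∧ ∃ (M : T) (n : Fin p → ℤ), IsTower (fun i => G⟦n i⟧) (E ⊞ M)}

/-- `h` is the categorical entropy of `F`: for every split-generator `G`,
`h = lim (1 / n) log δ(G, Fⁿ G)`. -/
def IsEntropy (F : T ≌ T) (h : ℝ) : Prop :=
  ∀ G : T, IsSplitGenerator G →
    Tendsto (fun n : ℕ => (1 / (n : ℝ)) * Real.log (complexity G (F.functor.obj^[n] G)))
      atTop (𝓝 h)

end Entropy

end

end StabCond

open StabCond

/-!
Let `σ` be the stability condition with `F.σ = σ.g` and let `L = log |r|`. Both inequalities are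
proved by comparison with `L`: the translation length of `F` *equals* `L`, and the entropy is at
least `L`.

* *The translation length is at most `L`* (`dBbar_glAct_le`). The matrix of `g` changes norms by a
  factor between `exp (-L)` and `exp L`, and, after a translation by an integer, the lift `f` moves
  no phase by more than `L` (`IsHyperbolicPair.exists_int_abs_sub_le`).

* *The translation length is at least `L`* (`le_dBbar`). The functor `F` and its inverse preserve
  the `σ`-semistable objects, and act on their central charges by the hyperbolic matrix. No
  semistable object has its central charge on an eigenline, since by the support property the masses
  of semistable objects are bounded below (`re_ne_zero_and_im_ne_zero`). Hence the masses of
  `F ^ n E` and of `F ^ (-n) E` both grow like `exp (n L)`. The masses for any other point of the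
  component differ from those for `σ` by a bounded factor, and the action of `ℂ` multiplies all
  masses by one factor, which cannot compensate the growth in both directions.

* *The entropy is at least `L`* (`le_of_isEntropy`). If a semistable object `E` is a direct summand
  of an iterated extension of `p` shifts of `G`, then its mass is at most `p` times a constant
  (`exists_norm_Z_le_of_builtFrom`). Instead of the triangle inequality for masses, this uses the
  heart `P((s, s + 1])` with `s` a half less than the phase of `E`: the imaginary part `height` of
  the rotated central charge is nonnegative on this heart, and the sum of its absolute values over
  the pieces of a filtration, ordered by their degrees, is subadditive (`Filt.insert`) and monotone
  under direct summands (`Filt.abs_height_le_of_retract`), while for `E` it is the mass.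

The entropy exists by Fekete's lemma, as complexities are submultiplicative (`BuiltFrom.trans`), and
masses and extremal phases may be computed from any Harder--Narasimhan filtration, as the
truncations of an object at an upper set of phases are unique.
-/

namespace StabCond

/-! ### Exact triangles without their morphisms -/

section Triangles

variable {T : Type u} [Category.{w} T] [HasZeroObject T] [HasShift T ℤ] [Preadditive T]
  [∀ n : ℤ, (shiftFunctor T n).Additive] [Pretriangulated T]

/-- The objects `X`, `Y`, `Z` fit into some exact triangle `X ⟶ Y ⟶ Z ⟶ X[1]`; equivalently,
`Y` is an extension of `Z` by `X`. -/
def IsTri (X Y Z : T) : Prop :=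
  ∃ (f : X ⟶ Y) (g : Y ⟶ Z) (h : Z ⟶ X⟦(1 : ℤ)⟧), Triangle.mk f g h ∈ distTriang T

lemma isTri_of_mem {t : Triangle T} (ht : t ∈ distTriang T) : IsTri t.obj₁ t.obj₂ t.obj₃ :=
  ⟨t.mor₁, t.mor₂, t.mor₃, ht⟩

lemma IsTri.of_iso {X Y Z X' Y' Z' : T} (h : IsTri X Y Z) (e₁ : X ≅ X') (e₂ : Y ≅ Y')
    (e₃ : Z ≅ Z') : IsTri X' Y' Z' := by
  obtain ⟨f, g, k, hT⟩ := h
  exact ⟨e₁.inv ≫ f ≫ e₂.hom, e₂.inv ≫ g ≫ e₃.hom, e₃.inv ≫ k ≫ e₁.hom⟦(1 : ℤ)⟧',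
    isomorphic_distinguished _ hT _ (Triangle.isoMk _ _ e₁.symm e₂.symm e₃.symm
      (by simp : (e₁.inv ≫ f ≫ e₂.hom) ≫ e₂.inv = e₁.inv ≫ f)
      (by simp : (e₂.inv ≫ g ≫ e₃.hom) ≫ e₃.inv = e₂.inv ≫ g)
      (by simp [← Functor.map_comp] :
        (e₃.inv ≫ k ≫ e₁.hom⟦(1 : ℤ)⟧') ≫ e₁.inv⟦(1 : ℤ)⟧' = e₃.inv ≫ k))⟩

lemma IsTri.rotate {X Y Z : T} (h : IsTri X Y Z) : IsTri Y Z (X⟦(1 : ℤ)⟧) := by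
  obtain ⟨f, g, k, hT⟩ := h
  exact isTri_of_mem (rot_of_distTriang _ hT)

lemma IsTri.invRotate {X Y Z : T} (h : IsTri X Y Z) : IsTri (Z⟦(-1 : ℤ)⟧) X Y := by
  obtain ⟨f, g, k, hT⟩ := h
  exact isTri_of_mem (inv_rot_of_distTriang _ hT)

lemma IsTri.shift {X Y Z : T} (h : IsTri X Y Z) (n : ℤ) : IsTri (X⟦n⟧) (Y⟦n⟧) (Z⟦n⟧) := by
  obtain ⟨f, g, k, hT⟩ := h
  exact isTri_of_mem (Triangle.shift_distinguished _ hT n)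

lemma IsTri.map {X Y Z : T} (h : IsTri X Y Z) (F : T ⥤ T) [F.CommShift ℤ] [F.IsTriangulated] :
    IsTri (F.obj X) (F.obj Y) (F.obj Z) := by
  obtain ⟨f, g, k, hT⟩ := h
  exact isTri_of_mem (F.map_distinguished _ hT)

lemma isTri_of_isZero_left {X Y : T} (hX : IsZero X) : IsTri X Y Y :=
  (isTri_of_mem (contractible_distinguished₁ Y)).of_iso ((isZero_zero T).iso hX) (Iso.refl _)
    (Iso.refl _)

lemma isTri_of_isZero_right {X Y : T} (hX : IsZero X) : IsTri Y Y X :=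
  (isTri_of_mem (contractible_distinguished Y)).of_iso (Iso.refl _) (Iso.refl _)
    ((isZero_zero T).iso hX)

lemma IsTri.iso_of_isZero_left {X Y Z : T} (h : IsTri X Y Z) (hX : IsZero X) :
    Nonempty (Y ≅ Z) := by
  obtain ⟨f, g, k, hT⟩ := h
  have : IsIso g := (Triangle.isZero₁_iff_isIso₂ _ hT).1 hX
  exact ⟨asIso g⟩

lemma isTri_biprod (X Y : T) : IsTri X (X ⊞ Y) Y :=
  isTri_of_mem (binaryBiproductTriangle_distinguished X Y)

lemma isTri_biprod' (X Y : T) : IsTri Y (X ⊞ Y) X :=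
  (isTri_biprod Y X).of_iso (Iso.refl _) (biprod.braiding _ _) (Iso.refl _)

/-- The octahedral axiom for a composition `X ⟶ Y ⟶ Z`, on the level of objects. -/
lemma IsTri.octahedron [IsTriangulated T] {X Y Z A B : T} (h : IsTri X Y A) (h' : IsTri Y Z B) :
    ∃ C, IsTri X Z C ∧ IsTri A C B := by
  obtain ⟨f, g, k, hT⟩ := h
  obtain ⟨f', g', k', hT'⟩ := h'
  obtain ⟨C, p, q, hC⟩ := distinguished_cocone_triangle (f ≫ f')
  exact ⟨C, ⟨_, _, _, hC⟩, ⟨_, _, _, (Triangulated.someOctahedron rfl hT hT' hC).mem⟩⟩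

/-- The octahedral axiom for a composition `Y ⟶ C ⟶ R`, on the level of objects. -/
lemma IsTri.octahedron' [IsTriangulated T] {X Y C K R : T} (h : IsTri X Y C)
    (h' : IsTri K C R) : ∃ Y', IsTri X Y' K ∧ IsTri Y' Y R := by
  obtain ⟨f, g, k, hT⟩ := h
  obtain ⟨f', g', k', hT'⟩ := h'
  obtain ⟨Y', p, q, hY⟩ := distinguished_cocone_triangle₁ (g ≫ g')
  exact ⟨Y', ⟨_, _, _, (Triangulated.someOctahedron' rfl hT hT' hY).mem⟩, ⟨_, _, _, hY⟩⟩

/-- A triangle whose connecting morphism vanishes can be read in the opposite order. -/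
lemma IsTri.swap {X Y Z : T} (h : IsTri X Y Z) (h0 : ∀ f : Z ⟶ X⟦(1 : ℤ)⟧, f = 0) :
    IsTri Z Y X := by
  obtain ⟨f, g, k, hT⟩ := h
  obtain ⟨e, -⟩ := exists_iso_binaryBiproduct_of_distTriang _ hT (h0 k)
  exact (isTri_biprod' X Z).of_iso (Iso.refl _) e.symm (Iso.refl _)

lemma IsTri.mk_eq {X Y Z : T} (h : IsTri X Y Z) : K0.mk Y = K0.mk X + K0.mk Z := by
  obtain ⟨f, g, k, hT⟩ := h
  exact K0.mk_triangle _ hT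

lemma K0.mk_of_isZero {X : T} (hX : IsZero X) : K0.mk X = 0 := by
  have h := (isTri_of_isZero_left (Y := X) hX).mk_eq
  simpa using h

lemma K0.mk_shift_one (X : T) : K0.mk (X⟦(1 : ℤ)⟧) = -K0.mk X := by
  have h := (isTri_of_isZero_right (isZero_zero T) (Y := X)).rotate.mk_eq
  rw [K0.mk_of_isZero (isZero_zero T)] at h
  rw [eq_neg_iff_add_eq_zero, add_comm, ← h]

/-- Retracts have complements. -/
lemma exists_iso_biprod_of_retract {X Y : T} (r : Retract X Y) :
    ∃ Z : T, Nonempty (Y ≅ X ⊞ Z) := by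
  obtain ⟨Z, g, k, hT⟩ := distinguished_cocone_triangle r.i
  have hk : k = 0 := by
    have : Mono r.i := SplitMono.mono ⟨r.r, r.retract⟩
    exact Triangle.mor₃_eq_zero_of_mono₁ _ hT this
  obtain ⟨e, -⟩ := exists_iso_binaryBiproduct_of_distTriang _ hT hk
  exact ⟨Z, ⟨e⟩⟩

/-- An extension of retracts is a retract of an extension. -/
lemma IsTri.exists_retract {X Y Z X' Z' : T} (h : IsTri X Y Z) (rX : Retract X X')
    (rZ : Retract Z Z') : ∃ Y', IsTri X' Y' Z' ∧ Nonempty (Retract Y Y') := by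
  obtain ⟨f, g, k, hT⟩ := h
  obtain ⟨Y', f', g', hT'⟩ := distinguished_cocone_triangle₂ (rZ.r ≫ k ≫ rX.i⟦(1 : ℤ)⟧')
  refine ⟨Y', ⟨_, _, _, hT'⟩, ?_⟩
  have key : k ≫ rX.i⟦(1 : ℤ)⟧' = rZ.i ≫ rZ.r ≫ k ≫ rX.i⟦(1 : ℤ)⟧' := by
    rw [← Category.assoc rZ.i, rZ.retract, Category.id_comp]
  have key' : (rZ.r ≫ k ≫ rX.i⟦(1 : ℤ)⟧') ≫ rX.r⟦(1 : ℤ)⟧' = rZ.r ≫ k := by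
    rw [Category.assoc, Category.assoc, ← Functor.map_comp, rX.retract,
      CategoryTheory.Functor.map_id, Category.comp_id]
  obtain ⟨b, hb₁, hb₂⟩ : ∃ b : Y ⟶ Y', f ≫ b = rX.i ≫ f' ∧ g ≫ rZ.i = b ≫ g' :=
    complete_distinguished_triangle_morphism₂ _ _ hT hT' rX.i rZ.i key
  obtain ⟨c, hc₁, hc₂⟩ : ∃ c : Y' ⟶ Y, f' ≫ c = rX.r ≫ f ∧ g' ≫ rZ.r = c ≫ g :=
    complete_distinguished_triangle_morphism₂ _ _ hT' hT rX.r rZ.r key'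
  have h₁ : f ≫ b ≫ c = 𝟙 X ≫ f := by
    rw [reassoc_of% hb₁, hc₁, Category.id_comp, ← Category.assoc, rX.retract, Category.id_comp]
  have h₂ : g ≫ 𝟙 Z = (b ≫ c) ≫ g := by
    rw [Category.assoc, ← hc₂, ← reassoc_of% hb₂, rZ.retract]
  have h₃ : k ≫ (𝟙 X)⟦(1 : ℤ)⟧' = 𝟙 Z ≫ k := by simp
  have : IsIso (b ≫ c) :=
    isIso₂_of_isIso₁₃ (Triangle.homMk (Triangle.mk f g k) (Triangle.mk f g k) (𝟙 X) (b ≫ c) (𝟙 Z)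
      h₁ h₂ h₃) hT hT (inferInstanceAs (IsIso (𝟙 X))) (inferInstanceAs (IsIso (𝟙 Z)))
  exact ⟨⟨b, c ≫ inv (b ≫ c), by rw [← Category.assoc, IsIso.hom_inv_id]⟩⟩

end Triangles

/-! ### Iterated extensions and the complexity of objects -/

section Shifts

variable {T : Type u} [Category.{w} T] [HasShift T ℤ]

/-- `A` is isomorphic to a shift of `G`. -/
def IsShiftOf (G A : T) : Prop := ∃ n : ℤ, Nonempty (G⟦n⟧ ≅ A)

lemma IsShiftOf.shift {G A : T} (h : IsShiftOf G A) (n : ℤ) : IsShiftOf G (A⟦n⟧) := by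
  obtain ⟨m, ⟨e⟩⟩ := h
  exact ⟨m + n, ⟨(shiftFunctorAdd T m n).app G ≪≫ (shiftFunctor T n).mapIso e⟩⟩

lemma isShiftOf_self (G : T) : IsShiftOf G G := ⟨0, ⟨(shiftFunctorZero T ℤ).app G⟩⟩

lemma IsShiftOf.map {G A : T} (h : IsShiftOf G A) (F : T ⥤ T) [F.CommShift ℤ] :
    IsShiftOf (F.obj G) (F.obj A) := by
  obtain ⟨m, ⟨e⟩⟩ := h
  exact ⟨m, ⟨((F.commShiftIso m).app G).symm ≪≫ F.mapIso e⟩⟩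

end Shifts

section Complexity

variable {T : Type u} [Category.{w} T] [HasZeroObject T] [HasShift T ℤ] [Preadditive T]
  [∀ n : ℤ, (shiftFunctor T n).Additive] [Pretriangulated T]

/-- A tower with `p + 1` steps is a tower with `p` steps, followed by one extension. -/
lemma IsTower.exists_isTri {p : ℕ} {A : Fin (p + 1) → T} {E : T} (h : IsTower A E) :
    ∃ E', IsTower (fun i => A i.castSucc) E' ∧ IsTri E' E (A (Fin.last p)) := by
  obtain ⟨X, h0, ⟨e⟩, hX⟩ := h
  refine ⟨X (Fin.last p).castSucc, ⟨fun i => X i.castSucc, h0, ⟨Iso.refl _⟩, fun i => ?_⟩, ?_⟩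
  · exact hX i.castSucc
  · have h1 : IsTri _ _ _ := hX (Fin.last p)
    exact h1.of_iso (Iso.refl _) e (Iso.refl _)

lemma IsTower.isZero {A : Fin 0 → T} {E : T} (h : IsTower A E) : IsZero E := by
  obtain ⟨X, h0, ⟨e⟩, -⟩ := h
  exact h0.of_iso e.symm

lemma isTower_of_isZero (A : Fin 0 → T) {E : T} (h : IsZero E) : IsTower A E :=
  ⟨fun _ => E, h, ⟨Iso.refl _⟩, fun i => i.elim0⟩

lemma IsTower.snoc {p : ℕ} {A : Fin p → T} {E E' B : T} (h : IsTower A E) (h' : IsTri E E' B) :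
    IsTower (Fin.snoc (α := fun _ => T) A B) E' := by
  obtain ⟨X, h0, ⟨e⟩, hX⟩ := h
  refine ⟨Fin.snoc (α := fun _ => T) X E', ?_, ⟨eqToIso (by simp)⟩, fun i => ?_⟩
  · rw [← Fin.castSucc_zero, Fin.snoc_castSucc]
    exact h0
  · change IsTri _ _ _
    induction i using Fin.lastCases with
    | last =>
      rw [Fin.snoc_castSucc, Fin.succ_last, Fin.snoc_last, Fin.snoc_last]
      exact h'.of_iso e.symm (Iso.refl _) (Iso.refl _)
    | cast i =>
      rw [Fin.snoc_castSucc, Fin.succ_castSucc, Fin.snoc_castSucc, Fin.snoc_castSucc]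
      exact hX i

/-- `X` is an iterated extension of `p` objects with the property `Q`. -/
inductive IterExt (Q : T → Prop) : ℕ → T → Prop
  | zero {X : T} (hX : IsZero X) : IterExt Q 0 X
  | step {p : ℕ} {X Y A : T} (hX : IterExt Q p X) (hA : Q A) (h : IsTri X Y A) :
      IterExt Q (p + 1) Y

lemma IterExt.of_iso {Q : T → Prop} {p : ℕ} {X Y : T} (h : IterExt Q p X) (e : X ≅ Y) :
    IterExt Q p Y := by
  cases h with
  | zero hX => exact .zero (hX.of_iso e.symm)
  | step hX hA h => exact .step hX hA (h.of_iso (Iso.refl _) e (Iso.refl _))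

lemma IterExt.trans [IsTriangulated T] {Q : T → Prop} {p q : ℕ} {X Y Z : T}
    (hX : IterExt Q p X) (hZ : IterExt Q q Z) (h : IsTri X Y Z) : IterExt Q (p + q) Y := by
  induction hZ generalizing Y with
  | zero hZ =>
    obtain ⟨e⟩ := h.invRotate.iso_of_isZero_left ((shiftFunctor T (-1 : ℤ)).map_isZero hZ)
    exact hX.of_iso e
  | step _ hA h' ih =>
    obtain ⟨Y', h₁, h₂⟩ := h.octahedron' h'
    exact .step (ih h₁) hA h₂

lemma IterExt.map {Q Q' : T → Prop} {p : ℕ} {X : T} (h : IterExt Q p X)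
    (F : T ⥤ T) [F.CommShift ℤ] [F.IsTriangulated] (hQ : ∀ A, Q A → Q' (F.obj A)) :
    IterExt Q' p (F.obj X) := by
  induction h with
  | zero hX => exact .zero (F.map_isZero hX)
  | step _ hA h ih => exact .step ih (hQ _ hA) (h.map F)

lemma IterExt.shift {Q : T → Prop} {p : ℕ} {X : T} (h : IterExt Q p X) (n : ℤ)
    (hQ : ∀ A, Q A → Q (A⟦n⟧)) : IterExt Q p (X⟦n⟧) := by
  induction h with
  | zero hX => exact .zero ((shiftFunctor T n).map_isZero hX)
  | step _ hA h ih => exact .step ih (hQ _ hA) (h.shift n)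

lemma iterExt_isShiftOf_iff {G E : T} {p : ℕ} :
    IterExt (IsShiftOf G) p E ↔ ∃ n : Fin p → ℤ, IsTower (fun i => G⟦n i⟧) E := by
  constructor
  · intro h
    induction h with
    | zero hX => exact ⟨0, isTower_of_isZero _ hX⟩
    | step _ hA h ih =>
      obtain ⟨n, hn⟩ := ih
      obtain ⟨m, ⟨e⟩⟩ := hA
      refine ⟨Fin.snoc (α := fun _ => ℤ) n m, ?_⟩
      have := hn.snoc (h.of_iso (Iso.refl _) (Iso.refl _) e.symm)
      convert this using 1
      funext i
      induction i using Fin.lastCases with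
      | last => simp
      | cast i => simp
  · rintro ⟨n, hn⟩
    induction p generalizing E with
    | zero => exact .zero hn.isZero
    | succ p ih =>
      obtain ⟨E', h₁, h₂⟩ := hn.exists_isTri
      exact .step (ih _ h₁) ⟨_, ⟨Iso.refl _⟩⟩ h₂

/-- `E` is a direct summand of an iterated extension of `p` shifts of `G`. -/
def BuiltFrom (G : T) (p : ℕ) (E : T) : Prop :=
  ∃ E', IterExt (IsShiftOf G) p E' ∧ Nonempty (Retract E E')

lemma builtFrom_iff {G E : T} {p : ℕ} :
    BuiltFrom G p E ↔ ∃ (M : T) (n : Fin p → ℤ), IsTower (fun i => G⟦n i⟧) (E ⊞ M) := by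
  constructor
  · rintro ⟨E', h, ⟨r⟩⟩
    obtain ⟨M, ⟨e⟩⟩ := exists_iso_biprod_of_retract r
    exact ⟨M, iterExt_isShiftOf_iff.1 (h.of_iso e)⟩
  · rintro ⟨M, h⟩
    exact ⟨_, iterExt_isShiftOf_iff.2 h, ⟨⟨biprod.inl, biprod.fst, by simp⟩⟩⟩

lemma complexity_eq (G E : T) : complexity G E = sInf {p : ℕ | 0 < p ∧ BuiltFrom G p E} := by
  simp only [complexity, builtFrom_iff]

lemma BuiltFrom.succ {G E : T} {p : ℕ} (h : BuiltFrom G p E) : BuiltFrom G (p + 1) E := by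
  obtain ⟨E', h, ⟨r⟩⟩ := h
  exact ⟨E' ⊞ G, .step h (isShiftOf_self G) (isTri_biprod E' G),
    ⟨r.trans ⟨biprod.inl, biprod.fst, by simp⟩⟩⟩

lemma BuiltFrom.retract {G E E' : T} {p : ℕ} (h : BuiltFrom G p E) (r : Retract E' E) :
    BuiltFrom G p E' := by
  obtain ⟨E'', h, ⟨r'⟩⟩ := h
  exact ⟨E'', h, ⟨r.trans r'⟩⟩

lemma BuiltFrom.shift {G E : T} {p : ℕ} (h : BuiltFrom G p E) (n : ℤ) :
    BuiltFrom G p (E⟦n⟧) := by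
  obtain ⟨E', h, ⟨r⟩⟩ := h
  exact ⟨_, h.shift n fun A hA => hA.shift n, ⟨r.map (shiftFunctor T n)⟩⟩

lemma BuiltFrom.map {G E : T} {p : ℕ} (h : BuiltFrom G p E) (F : T ⥤ T) [F.CommShift ℤ]
    [F.IsTriangulated] : BuiltFrom (F.obj G) p (F.obj E) := by
  obtain ⟨E', h, ⟨r⟩⟩ := h
  exact ⟨_, h.map F fun A hA => hA.map F, ⟨r.map F⟩⟩

lemma BuiltFrom.iterate_map {G E : T} {p : ℕ} (h : BuiltFrom G p E) (F : T ⥤ T) [F.CommShift ℤ]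
    [F.IsTriangulated] (n : ℕ) : BuiltFrom (F.obj^[n] G) p (F.obj^[n] E) := by
  induction n with
  | zero => exact h
  | succ n ih =>
    rw [Function.iterate_succ_apply', Function.iterate_succ_apply']
    exact ih.map F

lemma BuiltFrom.extension [IsTriangulated T] {G X Y Z : T} {p q : ℕ} (hX : BuiltFrom G p X)
    (hZ : BuiltFrom G q Z) (h : IsTri X Y Z) : BuiltFrom G (p + q) Y := by
  obtain ⟨X', hX', ⟨rX⟩⟩ := hX
  obtain ⟨Z', hZ', ⟨rZ⟩⟩ := hZ
  obtain ⟨Y', hY', r⟩ := h.exists_retract rX rZ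
  exact ⟨Y', hX'.trans hZ' hY', r⟩

lemma BuiltFrom.trans [IsTriangulated T] {A B C : T} {p q : ℕ} (h : BuiltFrom B p C)
    (h' : BuiltFrom A q B) : BuiltFrom A (p * q) C := by
  obtain ⟨C', hC', ⟨r⟩⟩ := h
  suffices BuiltFrom A (p * q) C' from this.retract r
  clear r
  induction hC' with
  | zero hX => exact ⟨_, by simpa using IterExt.zero hX, ⟨Retract.refl _⟩⟩
  | step _ hA h ih =>
    obtain ⟨n, ⟨e⟩⟩ := hA
    rw [Nat.succ_mul]
    exact ih.extension ((h'.shift n).retract (Retract.ofIso e.symm)) h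

lemma IsSplitGenerator.exists_builtFrom [IsTriangulated T] {G : T} (hG : IsSplitGenerator G)
    (E : T) : ∃ p, 0 < p ∧ BuiltFrom G p E := by
  let Q : ObjectProperty T := fun E => ∃ p, BuiltFrom G p E
  have : Q.IsStableUnderRetracts := ⟨fun r ⟨p, hp⟩ => ⟨p, hp.retract r⟩⟩
  have : Q.IsStableUnderShift ℤ :=
    ⟨fun n => ⟨fun X ⟨p, hp⟩ => ⟨p, hp.shift n⟩⟩⟩
  have : Q.ContainsZero := ⟨0, isZero_zero T, 0, 0, .zero (isZero_zero T), ⟨Retract.refl _⟩⟩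
  have : Q.IsTriangulatedClosed₂ := .mk' fun t ht ⟨p, hp⟩ ⟨q, hq⟩ =>
    ⟨p + q, hp.extension hq (isTri_of_mem ht)⟩
  have : Q.IsTriangulated := {}
  have h : (ObjectProperty.singleton G).triangEnvelope ≤ Q := by
    rw [ObjectProperty.triangEnvelope_le_iff]
    rintro X hX
    rw [ObjectProperty.singleton_iff] at hX
    obtain rfl := hX
    exact ⟨1, _, .step (.zero (isZero_zero T)) (isShiftOf_self _)
      (isTri_of_isZero_left (isZero_zero T)), ⟨Retract.refl _⟩⟩
  obtain ⟨p, hp⟩ := h E (by rw [show _ = ⊤ from hG]; trivial)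
  exact ⟨p + 1, p.succ_pos, hp.succ⟩

lemma complexity_le {G E : T} {p : ℕ} (hp : 0 < p) (h : BuiltFrom G p E) :
    complexity G E ≤ p := by
  rw [complexity_eq]
  exact Nat.sInf_le ⟨hp, h⟩

lemma complexity_spec {G E : T} (h : ∃ p, 0 < p ∧ BuiltFrom G p E) :
    0 < complexity G E ∧ BuiltFrom G (complexity G E) E := by
  rw [complexity_eq]
  exact Nat.sInf_mem h

end Complexity

/-! ### Truncations of a slicing and uniqueness of Harder--Narasimhan filtrations -/

section Truncation

variable {T : Type u} [Category.{w} T] [HasZeroObject T] [HasShift T ℤ] [Preadditive T]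
  [∀ n : ℤ, (shiftFunctor T n).Additive] [Pretriangulated T]
  {Λ : Type*} [AddCommGroup Λ] {v : K0 T →+ Λ}

namespace StabilityCondition

/-- The right orthogonal of the semistable objects with phase in `U`. For an upper set `U`, these
are zero and the objects whose Harder--Narasimhan factors all have phase outside `U`. -/
def Below (σ : StabilityCondition v) (U : Set ℝ) (Y : T) : Prop :=
  ∀ ψ ∈ U, ∀ A, σ.P ψ A → ∀ f : A ⟶ Y, f = 0

/-- The left orthogonal of `σ.Below U`. For an upper set `U`, these are zero and the objects whose
Harder--Narasimhan factors all have phase in `U`. -/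
def Above (σ : StabilityCondition v) (U : Set ℝ) (X : T) : Prop :=
  ∀ Y, σ.Below U Y → ∀ f : X ⟶ Y, f = 0

variable {σ : StabilityCondition v} {U V : Set ℝ} {X Y E : T}

lemma Above.of_mem {ψ : ℝ} (hψ : ψ ∈ U) (h : σ.P ψ X) : σ.Above U X :=
  fun _ hY f => hY ψ hψ X h f

lemma Below.of_mem (hU : IsUpperSet U) {ψ : ℝ} (hψ : ψ ∉ U) (h : σ.P ψ Y) : σ.Below U Y :=
  fun χ hχ A hA f => σ.hom_zero χ ψ A Y
    (lt_of_not_ge fun hle => hψ (hU hle hχ)) hA h f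

lemma Below.mono (h : σ.Below V Y) (hUV : U ⊆ V) : σ.Below U Y :=
  fun ψ hψ => h ψ (hUV hψ)

lemma Above.mono (h : σ.Above U X) (hUV : U ⊆ V) : σ.Above V X :=
  fun Y hY => h Y (hY.mono hUV)

lemma Below.of_isZero (hY : IsZero Y) : σ.Below U Y := fun _ _ _ _ f => hY.eq_of_tgt f 0

lemma Above.of_isZero (hX : IsZero X) : σ.Above U X := fun _ _ f => hX.eq_of_src f 0

lemma Below.of_retract (h : σ.Below U Y) (r : Retract X Y) : σ.Below U X := by
  intro ψ hψ A hA f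
  rw [← Category.comp_id f, ← r.retract, ← Category.assoc, h ψ hψ A hA (f ≫ r.i), zero_comp]

lemma Above.of_retract (h : σ.Above U Y) (r : Retract X Y) : σ.Above U X := by
  intro Z hZ f
  rw [← Category.id_comp f, ← r.retract, Category.assoc, h Z hZ (r.r ≫ f), comp_zero]

lemma Below.of_isTri (hX : σ.Below U X) (hY : σ.Below U Y) (h : IsTri X E Y) :
    σ.Below U E := by
  obtain ⟨a, b, c, hT⟩ := h
  intro ψ hψ A hA f
  obtain ⟨g, hg⟩ := Triangle.coyoneda_exact₂ _ hT f (hY ψ hψ A hA _)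
  rw [hg, hX ψ hψ A hA g]
  exact zero_comp

lemma Above.of_isTri (hX : σ.Above U X) (hY : σ.Above U Y) (h : IsTri X E Y) :
    σ.Above U E := by
  obtain ⟨a, b, c, hT⟩ := h
  intro Z hZ f
  obtain ⟨g, hg⟩ := Triangle.yoneda_exact₂ _ hT f (hX Z hZ _)
  rw [hg, hY Z hZ g]
  exact comp_zero

lemma Below.shift_neg_one (h : σ.Below V Y) (hUV : ∀ ψ ∈ U, ψ + 1 ∈ V) :
    σ.Below U (Y⟦(-1 : ℤ)⟧) := by
  intro ψ hψ A hA f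
  apply (shiftFunctor T (1 : ℤ)).map_injective
  have e : (Y⟦(-1 : ℤ)⟧)⟦(1 : ℤ)⟧ ≅ Y := (shiftFunctorCompIsoId T (-1 : ℤ) 1 (by simp)).app Y
  rw [Functor.map_zero, ← cancel_mono e.hom, zero_comp]
  exact h _ (hUV ψ hψ) _ ((σ.shift ψ A).1 hA) _

lemma Above.shift_one (h : σ.Above U X) (hUV : ∀ ψ ∈ U, ψ + 1 ∈ V) :
    σ.Above V (X⟦(1 : ℤ)⟧) := by
  intro Y hY f
  apply (shiftFunctor T (-1 : ℤ)).map_injective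
  have e : (X⟦(1 : ℤ)⟧)⟦(-1 : ℤ)⟧ ≅ X := (shiftFunctorCompIsoId T (1 : ℤ) (-1) (by simp)).app X
  rw [Functor.map_zero, ← cancel_epi e.inv, comp_zero]
  exact h _ (hY.shift_neg_one hUV) _

lemma shift_neg_one_mem {ψ : ℝ} {A : T} (hA : σ.P ψ A) : σ.P (ψ - 1) (A⟦(-1 : ℤ)⟧) := by
  rw [σ.shift, sub_add_cancel]
  exact σ.iso_mem _ _ _ ((shiftFunctorCompIsoId T (-1 : ℤ) 1 (by simp)).app A).symm hA

lemma Below.shift_one (h : σ.Below U Y) (hUV : ∀ ψ ∈ V, ψ - 1 ∈ U) :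
    σ.Below V (Y⟦(1 : ℤ)⟧) := by
  intro ψ hψ A hA f
  apply (shiftFunctor T (-1 : ℤ)).map_injective
  have e : (Y⟦(1 : ℤ)⟧)⟦(-1 : ℤ)⟧ ≅ Y := (shiftFunctorCompIsoId T (1 : ℤ) (-1) (by simp)).app Y
  rw [Functor.map_zero, ← cancel_mono e.hom, zero_comp]
  exact h _ (hUV ψ hψ) _ (shift_neg_one_mem hA) _

lemma add_one_mem (hU : IsUpperSet U) : ∀ ψ ∈ U, ψ + 1 ∈ U :=
  fun _ hψ => hU (by linarith) hψ

/-- The morphism `X ⟶ E` of a truncation triangle behaves like a monomorphism on the objects in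
`σ.Above U`. -/
lemma eq_zero_of_comp_eq_zero (hU : IsUpperSet U) {f : X ⟶ E} {g : E ⟶ Y}
    {k : Y ⟶ X⟦(1 : ℤ)⟧} (hT : Triangle.mk f g k ∈ distTriang T) (hY : σ.Below U Y) {Z : T}
    (hZ : σ.Above U Z) (a : Z ⟶ X) (ha : a ≫ f = 0) : a = 0 := by
  obtain ⟨b, hb⟩ := Triangle.coyoneda_exact₂ _ (inv_rot_of_distTriang _ hT) a ha
  rw [hb, hZ _ (hY.shift_neg_one (add_one_mem hU)) b]
  exact zero_comp

lemma isZero_left_of_hom_eq_zero (hU : IsUpperSet U) (h : IsTri X E Y) (hX : σ.Above U X)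
    (hY : σ.Below U Y) (h0 : ∀ f : X ⟶ E, f = 0) : IsZero X := by
  obtain ⟨f, g, k, hT⟩ := h
  exact (IsZero.iff_id_eq_zero X).2 (eq_zero_of_comp_eq_zero hU hT hY hX _ (h0 _))

lemma isZero_right_of_hom_eq_zero (hU : IsUpperSet U) (h : IsTri X E Y) (hX : σ.Above U X)
    (hY : σ.Below U Y) (h0 : ∀ f : E ⟶ Y, f = 0) : IsZero Y := by
  obtain ⟨f, g, k, hT⟩ := h
  rw [IsZero.iff_id_eq_zero]
  obtain ⟨b, hb⟩ := Triangle.yoneda_exact₃ _ hT (𝟙 Y) (h0 _)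
  rw [hb, hX.shift_one (add_one_mem hU) _ hY b]
  exact comp_zero

/-- Truncation triangles are unique. -/
lemma nonempty_iso_of_truncations (hU : IsUpperSet U) {X' Y' : T} (h : IsTri X E Y)
    (hX : σ.Above U X) (hY : σ.Below U Y) (h' : IsTri X' E Y') (hX' : σ.Above U X')
    (hY' : σ.Below U Y') : Nonempty (X ≅ X') := by
  obtain ⟨f, g, k, hT⟩ := h
  obtain ⟨f', g', k', hT'⟩ := h'
  obtain ⟨a, ha⟩ : ∃ a : X ⟶ X', f = a ≫ f' :=
    Triangle.coyoneda_exact₂ _ hT' f (hX _ hY' _)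
  obtain ⟨b, hb⟩ : ∃ b : X' ⟶ X, f' = b ≫ f :=
    Triangle.coyoneda_exact₂ _ hT f' (hX' _ hY _)
  refine ⟨⟨a, b, ?_, ?_⟩⟩
  · rw [← sub_eq_zero]
    apply eq_zero_of_comp_eq_zero hU hT hY hX
    rw [Preadditive.sub_comp, Category.assoc, ← hb, ← ha, Category.id_comp, sub_self]
  · rw [← sub_eq_zero]
    apply eq_zero_of_comp_eq_zero hU hT' hY' hX'
    rw [Preadditive.sub_comp, Category.assoc, ← ha, ← hb, Category.id_comp, sub_self]

end StabilityCondition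

lemma IsTower.mk_eq {p : ℕ} {A : Fin p → T} {E : T} (h : IsTower A E) :
    K0.mk E = ∑ i, K0.mk (A i) := by
  induction p generalizing E with
  | zero => simpa using K0.mk_of_isZero h.isZero
  | succ p ih =>
    obtain ⟨E', h₁, h₂⟩ := h.exists_isTri
    rw [h₂.mk_eq, ih h₁, Fin.sum_univ_castSucc]

namespace StabilityCondition

variable {σ : StabilityCondition v} {U V : Set ℝ}

lemma Above.of_isTower {p : ℕ} {A : Fin p → T} {E : T} (h : IsTower A E)
    (hA : ∀ i, σ.Above U (A i)) : σ.Above U E := by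
  induction p generalizing E with
  | zero => exact .of_isZero h.isZero
  | succ p ih =>
    obtain ⟨E', h₁, h₂⟩ := h.exists_isTri
    exact (ih h₁ fun i => hA _).of_isTri (hA _) h₂

lemma Below.of_isTower {p : ℕ} {A : Fin p → T} {E : T} (h : IsTower A E)
    (hA : ∀ i, σ.Below U (A i)) : σ.Below U E := by
  induction p generalizing E with
  | zero => exact .of_isZero h.isZero
  | succ p ih =>
    obtain ⟨E', h₁, h₂⟩ := h.exists_isTri
    exact (ih h₁ fun i => hA _).of_isTri (hA _) h₂

/-- Cutting a tower of semistable objects of decreasing phases at an upper set of phases. -/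
lemma exists_truncation_of_isTower [IsTriangulated T] (hU : IsUpperSet U) {p : ℕ}
    {A : Fin p → T} {φ : Fin p → ℝ} (hφ : StrictAnti φ) (hA : ∀ i, σ.P (φ i) (A i)) {E : T}
    (h : IsTower A E) : ∃ X Y, IsTri X E Y ∧ σ.Above U X ∧ σ.Below U Y ∧
      K0.mk X = ∑ i, U.indicator (fun _ => K0.mk (A i)) (φ i) := by
  induction p generalizing E with
  | zero =>
    exact ⟨E, 0, isTri_of_isZero_right (isZero_zero T), .of_isZero h.isZero,
      .of_isZero (isZero_zero T), by simpa using K0.mk_of_isZero h.isZero⟩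
  | succ p ih =>
    by_cases hl : φ (Fin.last p) ∈ U
    · have hall : ∀ i, φ i ∈ U := fun i => hU (hφ.antitone (Fin.le_last i)) hl
      refine ⟨E, 0, isTri_of_isZero_right (isZero_zero T),
        .of_isTower h fun i => .of_mem (hall i) (hA i), .of_isZero (isZero_zero T), ?_⟩
      rw [h.mk_eq]
      exact Finset.sum_congr rfl fun i _ => by rw [Set.indicator_of_mem (hall i)]
    · obtain ⟨E', h₁, h₂⟩ := h.exists_isTri
      obtain ⟨X, Y, hXY, hX, hY, hc⟩ := ih (φ := fun i => φ i.castSucc)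
        (fun i j hij => hφ (Fin.castSucc_lt_castSucc_iff.2 hij)) (fun i => hA _) h₁
      obtain ⟨C, hC, hC'⟩ := hXY.octahedron h₂
      refine ⟨X, C, hC, hX, hY.of_isTri (.of_mem hU hl (hA _)) hC', ?_⟩
      rw [hc, Fin.sum_univ_castSucc, Set.indicator_of_notMem hl, add_zero]

lemma exists_truncation [IsTriangulated T] (σ : StabilityCondition v) (hU : IsUpperSet U)
    (E : T) : ∃ X Y, IsTri X E Y ∧ σ.Above U X ∧ σ.Below U Y := by
  by_cases hE : IsZero E
  · exact ⟨E, 0, isTri_of_isZero_right (isZero_zero T), .of_isZero hE,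
      .of_isZero (isZero_zero T)⟩
  · obtain ⟨H⟩ := σ.hn E hE
    obtain ⟨X, Y, h, hX, hY, -⟩ := exists_truncation_of_isTower hU H.strictAnti H.mem H.tower
    exact ⟨X, Y, h, hX, hY⟩

lemma Z_ne_zero (σ : StabilityCondition v) {φ : ℝ} {E : T} (h : σ.P φ E) (hE : ¬ IsZero E) :
    σ.Z (v (K0.mk E)) ≠ 0 := by
  obtain ⟨m, hm, h⟩ := σ.compat φ E h hE
  rw [h]
  exact mul_ne_zero (by exact_mod_cast hm.ne') (Complex.exp_ne_zero _)

lemma above_iff (H : HNFiltration σ.P E) (hU : IsUpperSet U) :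
    σ.Above U E ↔ H.phase (Fin.last _) ∈ U := by
  refine ⟨fun h => by_contra fun hl => ?_, fun hl => .of_isTower H.tower fun i =>
    .of_mem (hU (H.strictAnti.antitone (Fin.le_last i)) hl) (H.mem i)⟩
  obtain ⟨E', h₁, h₂⟩ := H.tower.exists_isTri
  refine H.nonzero _ (isZero_right_of_hom_eq_zero (isUpperSet_Ioi (H.phase (Fin.last _))) h₂
    (.of_isTower h₁ fun i => .of_mem (H.strictAnti (Fin.castSucc_lt_last i)) (H.mem _))
    (.of_mem (isUpperSet_Ioi _) (by simp) (H.mem _)) (h _ (.of_mem hU hl (H.mem _))))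

lemma below_iff [IsTriangulated T] (H : HNFiltration σ.P E) (hU : IsUpperSet U) :
    σ.Below U E ↔ H.phase 0 ∉ U := by
  refine ⟨fun h hl => ?_, fun hl => .of_isTower H.tower fun i =>
    .of_mem hU (fun hi => hl (hU (H.strictAnti.antitone (Fin.zero_le i)) hi)) (H.mem i)⟩
  obtain ⟨X, Y, hXY, hX, hY, hc⟩ := exists_truncation_of_isTower
    (isUpperSet_Ici (H.phase 0)) H.strictAnti H.mem H.tower
  have hVU : Set.Ici (H.phase 0) ⊆ U := fun ψ hψ => hU hψ hl
  have hX0 := isZero_left_of_hom_eq_zero (isUpperSet_Ici _) hXY hX hY ((hX.mono hVU) _ h)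
  -- the truncation `X` has the class of the first factor, whose central charge is not zero
  rw [K0.mk_of_isZero hX0, Finset.sum_eq_single 0, Set.indicator_of_mem (by simp)] at hc
  · apply σ.Z_ne_zero (H.mem 0) (H.nonzero 0)
    rw [← hc, map_zero, map_zero]
  · intro i _ hi
    exact Set.indicator_of_notMem
      (fun hmem => (H.strictAnti (Fin.pos_of_ne_zero hi)).not_ge hmem) _
  · simp

lemma phase_last_unique (H H' : HNFiltration σ.P E) :
    H.phase (Fin.last _) = H'.phase (Fin.last _) := by
  refine le_antisymm ?_ ?_
  · have := (above_iff H (isUpperSet_Ici (H.phase (Fin.last _)))).2 (by simp)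
    exact (above_iff H' (isUpperSet_Ici _)).1 this
  · have := (above_iff H' (isUpperSet_Ici (H'.phase (Fin.last _)))).2 (by simp)
    exact (above_iff H (isUpperSet_Ici _)).1 this

lemma phase_zero_unique [IsTriangulated T] (H H' : HNFiltration σ.P E) :
    H.phase 0 = H'.phase 0 := by
  refine le_antisymm ?_ ?_
  · have := (below_iff H' (isUpperSet_Ioi (H'.phase 0))).2 (by simp)
    simpa using (below_iff H (isUpperSet_Ioi _)).1 this
  · have := (below_iff H (isUpperSet_Ioi (H.phase 0))).2 (by simp)
    simpa using (below_iff H' (isUpperSet_Ioi _)).1 this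

/-- A family of vectors indexed by distinct real numbers is determined, up to reindexing and zero
terms, by its sums over upper sets; here, for the sum of the norms. -/
lemma _root_.StabCond.sum_norm_eq_of_sum_indicator_eq {ι κ : Type w} [Fintype ι] [Fintype κ]
    {φ : ι → ℝ} {φ' : κ → ℝ} (hφ : Function.Injective φ) (hφ' : Function.Injective φ')
    {a : ι → ℂ} {a' : κ → ℂ}
    (h : ∀ U : Set ℝ, IsUpperSet U →
      ∑ i, U.indicator (fun _ => a i) (φ i) = ∑ j, U.indicator (fun _ => a' j) (φ' j)) :
    ∑ i, ‖a i‖ = ∑ j, ‖a' j‖ := by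
  classical
  have hdiff : ∀ (t x : ℝ) (z : ℂ), (Set.Ici t).indicator (fun _ => z) x -
      (Set.Ioi t).indicator (fun _ => z) x = if x = t then z else 0 := by
    intro t x z
    simp only [Set.indicator_apply, Set.mem_Ici, Set.mem_Ioi]
    rcases lt_trichotomy x t with hx | hx | hx
    · simp [hx.not_ge, hx.not_gt, hx.ne]
    · simp [hx]
    · simp [hx, hx.le, hx.ne']
  have hpt : ∀ t : ℝ, (∑ i, if φ i = t then a i else 0) = ∑ j, if φ' j = t then a' j else 0 := by
    intro t
    simp only [← hdiff, Finset.sum_sub_distrib]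
    rw [h _ (isUpperSet_Ici t), h _ (isUpperSet_Ioi t)]
  have key : ∀ {ι : Type w} [Fintype ι] {φ : ι → ℝ} (_ : Function.Injective φ) (a : ι → ℂ)
      (S : Finset ℝ) (_ : ∀ i, φ i ∈ S),
      ∑ i, ‖a i‖ = ∑ t ∈ S, ‖∑ i, if φ i = t then a i else 0‖ := by
    intro ι _ φ hφ a S hS
    have h1 : ∀ i, ‖a i‖ = ∑ t ∈ S, if φ i = t then ‖a i‖ else 0 := by
      intro i
      rw [Finset.sum_ite_eq, if_pos (hS i)]
    rw [Finset.sum_congr rfl fun i _ => h1 i, Finset.sum_comm]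
    refine Finset.sum_congr rfl fun t _ => ?_
    by_cases ht : ∃ i, φ i = t
    · obtain ⟨i, rfl⟩ := ht
      simp [hφ.eq_iff]
    · push Not at ht
      simp [ht]
  have h1 := key hφ a (Finset.univ.image φ ∪ Finset.univ.image φ') (by simp)
  have h2 := key hφ' a' (Finset.univ.image φ ∪ Finset.univ.image φ') (by simp)
  rw [h1, h2]
  simp only [hpt]

lemma mass_unique [IsTriangulated T] (H H' : HNFiltration σ.P E) :
    ∑ i, ‖σ.Z (v (K0.mk (H.factor i)))‖ = ∑ i, ‖σ.Z (v (K0.mk (H'.factor i)))‖ := by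
  refine sum_norm_eq_of_sum_indicator_eq H.strictAnti.injective H'.strictAnti.injective
    fun U hU => ?_
  obtain ⟨X, Y, h, hX, hY, hc⟩ := exists_truncation_of_isTower hU H.strictAnti H.mem H.tower
  obtain ⟨X', Y', h', hX', hY', hc'⟩ :=
    exists_truncation_of_isTower hU H'.strictAnti H'.mem H'.tower
  obtain ⟨e⟩ := nonempty_iso_of_truncations hU h hX hY h' hX' hY'
  have := congrArg (fun x => σ.Z (v x)) (hc.symm.trans ((K0.mk_iso e).trans hc'))
  have hind : ∀ (x : K0 T) (t : ℝ), σ.Z (v (U.indicator (fun _ => x) t)) =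
      U.indicator (fun _ => σ.Z (v x)) t := by
    intro x t
    by_cases ht : t ∈ U
    · rw [Set.indicator_of_mem ht, Set.indicator_of_mem ht]
    · rw [Set.indicator_of_notMem ht, Set.indicator_of_notMem ht, map_zero, map_zero]
  simpa only [map_sum, hind] using this

lemma phiPlus_eq [IsTriangulated T] (hE : ¬ IsZero E) (H : HNFiltration σ.P E) :
    σ.phiPlus E hE = H.phase 0 := phase_zero_unique _ _

lemma phiMinus_eq (hE : ¬ IsZero E) (H : HNFiltration σ.P E) :
    σ.phiMinus E hE = H.phase (Fin.last _) := phase_last_unique _ _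

lemma mass_eq [IsTriangulated T] (hE : ¬ IsZero E) (H : HNFiltration σ.P E) :
    σ.mass E hE = ∑ i, ‖σ.Z (v (K0.mk (H.factor i)))‖ := mass_unique _ _

lemma mass_pos (σ : StabilityCondition v) (E : T) (hE : ¬ IsZero E) : 0 < σ.mass E hE :=
  Finset.sum_pos (fun i _ => norm_pos_iff.2
    (σ.Z_ne_zero ((σ.hnf E hE).mem i) ((σ.hnf E hE).nonzero i))) ⟨0, Finset.mem_univ _⟩

/-- The one-step Harder--Narasimhan filtration of a semistable object. -/
def _root_.StabCond.HNFiltration.ofMem {P : ℝ → ObjectProperty T} {E : T} {φ : ℝ} (h : P φ E)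
    (hE : ¬ IsZero E) : HNFiltration P E where
  len := 0
  phase _ := φ
  factor _ := E
  strictAnti i j hij := by omega
  mem _ := h
  nonzero _ := hE
  tower := by
    have h1 := (isTower_of_isZero (fun _ => E) (isZero_zero T)).snoc
      (isTri_of_isZero_left (isZero_zero T) (Y := E))
    convert h1 using 1
    funext i
    obtain rfl : i = Fin.last 0 := Fin.ext (by simp)
    rw [Fin.snoc_last]

lemma mass_of_mem [IsTriangulated T] {φ : ℝ} (h : σ.P φ E) (hE : ¬ IsZero E) :
    σ.mass E hE = ‖σ.Z (v (K0.mk E))‖ := by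
  rw [mass_eq hE (HNFiltration.ofMem h hE)]
  exact Fin.sum_univ_one _

lemma mass_iso [IsTriangulated T] {E' : T} (e : E ≅ E') (hE : ¬ IsZero E) (hE' : ¬ IsZero E') :
    σ.mass E hE = σ.mass E' hE' := by
  let H := σ.hnf E hE
  exact (mass_eq hE' ⟨H.len, H.phase, H.factor, H.strictAnti, H.mem, H.nonzero,
    H.tower.of_iso e⟩).symm

end StabilityCondition

end Truncation

/-! ### A lower bound for the complexity of semistable objects -/

section Mass

variable {T : Type u} [Category.{w} T] [HasZeroObject T] [HasShift T ℤ] [Preadditive T]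
  [∀ n : ℤ, (shiftFunctor T n).Additive] [Pretriangulated T]
  {Λ : Type*} [AddCommGroup Λ] {v : K0 T →+ Λ}

namespace StabilityCondition

variable (σ : StabilityCondition v) (s : ℝ)

/-- The coordinate of the central charge of `X` orthogonal to the ray of phase `s`. -/
noncomputable def height (X : T) : ℝ :=
  (Complex.exp (-(Complex.I * Real.pi * s)) * σ.Z (v (K0.mk X))).im

/-- The shift by `[n]` of the heart `P((s, s + 1])`. -/
def Slice (n : ℤ) (X : T) : Prop :=
  σ.Above (Set.Ioi (s + n)) X ∧ σ.Below (Set.Ioi (s + n + 1)) X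

variable {σ s}

lemma height_of_isTri {X Y Z : T} (h : IsTri X Y Z) :
    σ.height s Y = σ.height s X + σ.height s Z := by
  simp only [height, h.mk_eq, map_add, mul_add, Complex.add_im]

lemma height_of_isZero {X : T} (h : IsZero X) : σ.height s X = 0 := by
  simp [height, K0.mk_of_isZero h]

lemma height_shift_one (X : T) : σ.height s (X⟦(1 : ℤ)⟧) = -σ.height s X := by
  simp [height, K0.mk_shift_one]

lemma abs_height_le (X : T) : |σ.height s X| ≤ ‖σ.Z (v (K0.mk X))‖ := by
  refine (Complex.abs_im_le_norm _).trans ?_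
  rw [norm_mul, show -(Complex.I * Real.pi * s) = ((-(Real.pi * s) : ℝ) : ℂ) * Complex.I by
    push_cast; ring, Complex.norm_exp_ofReal_mul_I, one_mul]

lemma height_of_mem {φ : ℝ} {X : T} (h : σ.P φ X) (hX : ¬ IsZero X) :
    σ.height s X = ‖σ.Z (v (K0.mk X))‖ * Real.sin (Real.pi * (φ - s)) := by
  obtain ⟨m, hm, h⟩ := σ.compat φ X h hX
  rw [height, h, norm_mul, mul_left_comm, ← Complex.exp_add,
    show -(Complex.I * Real.pi * s) + Complex.I * Real.pi * φ =
      ((Real.pi * (φ - s) : ℝ) : ℂ) * Complex.I by push_cast; ring,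
    show Complex.I * Real.pi * φ = ((Real.pi * φ : ℝ) : ℂ) * Complex.I by push_cast; ring,
    Complex.norm_exp_ofReal_mul_I, Complex.im_ofReal_mul, Complex.exp_ofReal_mul_I_im,
    Complex.norm_real, Real.norm_of_nonneg hm.le, mul_one]

lemma Slice.of_retract {n : ℤ} {X Y : T} (h : σ.Slice s n Y) (r : Retract X Y) :
    σ.Slice s n X := ⟨h.1.of_retract r, h.2.of_retract r⟩

lemma Slice.of_isTri {n : ℤ} {X Y Z : T} (hX : σ.Slice s n X) (hZ : σ.Slice s n Z)
    (h : IsTri X Y Z) : σ.Slice s n Y := ⟨hX.1.of_isTri hZ.1 h, hX.2.of_isTri hZ.2 h⟩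

lemma Slice.of_isZero {n : ℤ} {X : T} (h : IsZero X) : σ.Slice s n X :=
  ⟨.of_isZero h, .of_isZero h⟩

lemma exists_slice_of_mem {φ : ℝ} {X : T} (h : σ.P φ X) (s : ℝ) : ∃ n, σ.Slice s n X := by
  refine ⟨⌈φ - s⌉ - 1, .of_mem ?_ h, .of_mem (isUpperSet_Ioi _) ?_ h⟩
  · have := Int.ceil_lt_add_one (φ - s)
    push_cast
    rw [Set.mem_Ioi]
    linarith
  · have := Int.le_ceil (φ - s)
    push_cast
    rw [Set.mem_Ioi]
    linarith

/-- The height is nonnegative on the heart, and changes sign with each shift. -/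
lemma Slice.height_nonneg [IsTriangulated T] {n : ℤ} {X : T} (h : σ.Slice s n X) :
    0 ≤ (-1 : ℝ) ^ n * σ.height s X := by
  by_cases hX : IsZero X
  · rw [height_of_isZero hX, mul_zero]
  obtain ⟨H⟩ := σ.hn X hX
  have h₁ := (above_iff H (isUpperSet_Ioi _)).1 h.1
  have h₂ := (below_iff H (isUpperSet_Ioi _)).1 h.2
  rw [Set.mem_Ioi] at h₁ h₂
  have hsum : σ.height s X = ∑ i, σ.height s (H.factor i) := by
    simp only [height, H.tower.mk_eq, map_sum, Finset.mul_sum, Complex.im_sum]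
  rw [hsum, Finset.mul_sum]
  refine Finset.sum_nonneg fun i _ => ?_
  have hi₁ : s + n < H.phase i := h₁.trans_le (H.strictAnti.antitone (Fin.le_last i))
  have hi₂ : H.phase i ≤ s + n + 1 :=
    (H.strictAnti.antitone (Fin.zero_le i)).trans (not_lt.1 h₂)
  rw [height_of_mem (H.mem i) (H.nonzero i), mul_left_comm, ← Real.sin_sub_int_mul_pi]
  refine mul_nonneg (norm_nonneg _) (Real.sin_nonneg_of_nonneg_of_le_pi ?_ ?_)
  · nlinarith [Real.pi_pos]
  · nlinarith [Real.pi_pos]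

lemma Slice.abs_height [IsTriangulated T] {n : ℤ} {X : T} (h : σ.Slice s n X) :
    |σ.height s X| = (-1 : ℝ) ^ n * σ.height s X := by
  rw [← abs_of_nonneg h.height_nonneg, abs_mul, abs_zpow, abs_neg, abs_one, one_zpow, one_mul]

/-- An extension of an object of the heart `P((s, s + 1])[a]` by one of `P((s, s + 1])[n]`, where
`n < a`, can be rewritten with these two in the correct order, without increasing the absolute
values of the heights. For `a = n + 1` these are the kernel and the cokernel of the connecting
morphism. -/
lemma exists_reorder [IsTriangulated T] {n a : ℤ} (hna : n < a) {B Q A : T}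
    (hB : σ.Slice s n B) (hA : σ.Slice s a A) (h : IsTri B Q A) :
    ∃ K R, σ.Slice s a K ∧ σ.Slice s n R ∧ IsTri K Q R ∧
      |σ.height s K| + |σ.height s R| ≤ |σ.height s B| + |σ.height s A| := by
  have hB₁ : σ.Below (Set.Ioi (s + n + 2)) (B⟦(1 : ℤ)⟧) := hB.2.shift_one fun ψ hψ => by
    rw [Set.mem_Ioi] at hψ ⊢
    linarith
  rcases (Int.add_one_le_iff.2 hna).lt_or_eq with hlt | rfl
  · refine ⟨A, B, hA, hB, h.swap (hA.1 _ (hB₁.mono (Set.Ioi_subset_Ioi ?_))), by rw [add_comm]⟩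
    have : ((n + 1 + 1 : ℤ) : ℝ) ≤ a := by exact_mod_cast hlt
    push_cast at this
    linarith
  · obtain ⟨K, R, hKR, hK, hR⟩ := σ.exists_truncation (isUpperSet_Ioi (s + n + 1)) Q
    have hAa : σ.Above (Set.Ioi (s + n + 1)) A := by simpa [add_assoc] using hA.1
    have hAb : σ.Below (Set.Ioi (s + n + 2)) A := by
      have := hA.2
      push_cast at this
      rwa [show s + ((n : ℝ) + 1) + 1 = s + n + 2 by ring] at this
    have hQ₁ : σ.Above (Set.Ioi (s + n)) Q :=
      hB.1.of_isTri (hAa.mono (Set.Ioi_subset_Ioi (by linarith))) h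
    have hQ₂ : σ.Below (Set.Ioi (s + n + 2)) Q :=
      (hB.2.mono (Set.Ioi_subset_Ioi (by linarith))).of_isTri hAb h
    have hK₁ : σ.Above (Set.Ioi (s + n + 1)) (K⟦(1 : ℤ)⟧) :=
      hK.shift_one fun ψ hψ => by rw [Set.mem_Ioi] at *; linarith
    have hRn : σ.Below (Set.Ioi (s + n + 2)) (R⟦(-1 : ℤ)⟧) :=
      hR.shift_neg_one fun ψ hψ => by rw [Set.mem_Ioi] at *; linarith
    have hKs : σ.Slice s (n + 1) K := by
      have := hRn.of_isTri hQ₂ hKR.invRotate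
      constructor
      · simpa [add_assoc] using hK
      · push_cast
        rwa [show s + ((n : ℝ) + 1) + 1 = s + n + 2 by ring]
    have hRs : σ.Slice s n R :=
      ⟨hQ₁.of_isTri (hK₁.mono (Set.Ioi_subset_Ioi (by linarith))) hKR.rotate, hR⟩
    -- `J` is the image of the connecting morphism `A ⟶ B[1]`
    obtain ⟨J, hJ, hJ'⟩ := hKR.octahedron h.rotate
    have hJs : σ.Slice s (n + 1) J := by
      have h1 := hAa.of_isTri hK₁ hJ.rotate
      have h2 := (hR.mono (Set.Ioi_subset_Ioi (by linarith))).of_isTri hB₁ hJ'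
      constructor
      · simpa [add_assoc] using h1
      · push_cast
        rwa [show s + ((n : ℝ) + 1) + 1 = s + n + 2 by ring]
    refine ⟨K, R, hKs, hRs, hKR, ?_⟩
    have e1 := height_of_isTri (σ := σ) (s := s) hJ
    have e2 := height_of_isTri (σ := σ) (s := s) hJ'
    rw [height_shift_one] at e2
    have hJn := hJs.height_nonneg
    rw [hKs.abs_height, hRs.abs_height, hB.abs_height, hA.abs_height, e1]
    rw [zpow_add_one₀ (by norm_num)] at *
    rw [e2] at *
    nlinarith

variable (σ s)

/-- `X` is an iterated extension of objects `Xₘ` in `P((s, s + 1])[m]`, for decreasing `m ≥ n`,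
for which the sum of the `|height s Xₘ|` is at most `c`. -/
inductive Filt : ℤ → T → ℝ → Prop
  | zero {n : ℤ} {X : T} {c : ℝ} (hX : IsZero X) (hc : 0 ≤ c) : Filt n X c
  | step {n : ℤ} {X Y B : T} {c c' : ℝ} (hX : Filt (n + 1) X c') (hB : σ.Slice s n B)
      (h : IsTri X Y B) (hc : c' + |σ.height s B| ≤ c) : Filt n Y c

variable {σ s}

lemma Filt.nonneg {n : ℤ} {X : T} {c : ℝ} (h : σ.Filt s n X c) : 0 ≤ c := by
  induction h with
  | zero _ hc => exact hc
  | step _ _ _ hc ih => exact (add_nonneg ih (abs_nonneg _)).trans hc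

lemma Filt.of_iso {n : ℤ} {X Y : T} {c : ℝ} (h : σ.Filt s n X c) (e : X ≅ Y) :
    σ.Filt s n Y c := by
  cases h with
  | zero hX hc => exact .zero (hX.of_iso e.symm) hc
  | step hX hB h hc => exact .step hX hB (h.of_iso (Iso.refl _) e (Iso.refl _)) hc

lemma Filt.above {n : ℤ} {X : T} {c : ℝ} (h : σ.Filt s n X c) :
    σ.Above (Set.Ioi (s + n)) X := by
  induction h with
  | zero hX _ => exact .of_isZero hX
  | step _ hB h _ ih =>
    refine (ih.mono (Set.Ioi_subset_Ioi ?_)).of_isTri hB.1 h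
    push_cast
    linarith

lemma Filt.of_add_one {n : ℤ} {X : T} {c : ℝ} (h : σ.Filt s (n + 1) X c) : σ.Filt s n X c :=
  .step h (.of_isZero (isZero_zero T)) (isTri_of_isZero_right (isZero_zero T))
    (by rw [height_of_isZero (isZero_zero T), abs_zero, add_zero])

lemma Filt.of_le {n m : ℤ} (hmn : m ≤ n) {X : T} {c : ℝ} (h : σ.Filt s n X c) :
    σ.Filt s m X c := by
  induction n, hmn using Int.leInduction with
  | base => exact h
  | succ n _ ih => exact ih h.of_add_one

lemma Filt.insert [IsTriangulated T] {n : ℤ} {X : T} {c : ℝ} (hX : σ.Filt s n X c) {a : ℤ}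
    (ha : n ≤ a) {Y A : T} (hA : σ.Slice s a A) (h : IsTri X Y A) :
    σ.Filt s n Y (c + |σ.height s A|) := by
  induction hX generalizing a Y A with
  | zero hX hc => exact (Filt.step (.zero hX hc) hA h le_rfl).of_le ha
  | @step n X' X B c c' hX' hB h' hc ih =>
    obtain ⟨Q, hQ, hQ'⟩ := h'.octahedron h
    rcases ha.eq_or_lt with rfl | hlt
    · have hQs := hB.of_isTri hA hQ'
      refine .step hX' hQs hQ ?_
      rw [hQs.abs_height, height_of_isTri hQ', mul_add, ← hB.abs_height, ← hA.abs_height]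
      linarith
    · obtain ⟨K, R, hK, hR, hKR, hle⟩ := exists_reorder hlt hB hA hQ'
      obtain ⟨Y', h₁, h₂⟩ := hQ.octahedron' hKR
      exact .step (ih (Int.add_one_le_iff.2 hlt) hK h₁) hR h₂ (by linarith)

lemma Filt.exists_insert_of_isTower [IsTriangulated T] {p : ℕ} {A : Fin p → T} {φ : Fin p → ℝ}
    (hA : ∀ i, σ.P (φ i) (A i)) {E X Y : T} (hE : IsTower A E) {n : ℤ} {c : ℝ}
    (hX : σ.Filt s n X c) (h : IsTri X Y E) :
    ∃ m, σ.Filt s m Y (c + ∑ i, |σ.height s (A i)|) := by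
  induction p generalizing E Y with
  | zero =>
    obtain ⟨e⟩ := h.invRotate.iso_of_isZero_left ((shiftFunctor T (-1 : ℤ)).map_isZero hE.isZero)
    exact ⟨n, by simpa using hX.of_iso e⟩
  | succ p ih =>
    obtain ⟨E', h₁, h₂⟩ := hE.exists_isTri
    obtain ⟨Y', h₃, h₄⟩ := h.octahedron' h₂
    obtain ⟨m, hm⟩ := ih (φ := fun i => φ i.castSucc) (fun i => hA _) h₁ h₃
    obtain ⟨a, ha⟩ := exists_slice_of_mem (hA (Fin.last p)) s
    refine ⟨min m a, ?_⟩
    rw [Fin.sum_univ_castSucc, ← add_assoc]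
    exact (hm.of_le (min_le_left _ _)).insert (min_le_right _ _) ha h₄

/-- The heights of the pieces of a filtration bound the height of every direct summand that lies
in a shift of the heart. -/
lemma Filt.abs_height_le_of_retract [IsTriangulated T] {n : ℤ} {X : T} {c : ℝ}
    (hX : σ.Filt s n X c) {m : ℤ} {E : T} (hE : σ.Slice s m E) (r : Retract E X) :
    |σ.height s E| ≤ c := by
  have hzero : ∀ {c : ℝ}, 0 ≤ c → IsZero E → |σ.height s E| ≤ c := fun hc hE0 => by
    rwa [height_of_isZero hE0, abs_zero]
  induction hX with
  | zero hX hc =>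
    exact hzero hc ((IsZero.iff_id_eq_zero E).2 (by
      rw [← r.retract, hX.eq_of_tgt r.i 0, zero_comp]))
  | @step n X Y B c c' hX hB h hc ih =>
    have hc0 := hX.nonneg
    have hB0 := abs_nonneg (σ.height s B)
    rcases lt_trichotomy m n with hlt | rfl | hlt
    · have hY : σ.Above (Set.Ioi (s + m + 1)) Y := (Filt.step hX hB h hc).above.mono
        (Set.Ioi_subset_Ioi (by
          have : ((m + 1 : ℤ) : ℝ) ≤ n := by exact_mod_cast hlt
          push_cast at this
          linarith))
      refine hzero (by linarith) ((IsZero.iff_id_eq_zero E).2 ?_)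
      rw [← r.retract, hY _ hE.2 r.r, comp_zero]
    · obtain ⟨f, g, k, hT⟩ := h
      have hXa := hX.above
      push_cast at hXa
      rw [← add_assoc] at hXa
      obtain ⟨q, hq⟩ : ∃ q : B ⟶ E, r.r = g ≫ q :=
        Triangle.yoneda_exact₂ _ hT r.r (hXa _ hE.2 _)
      have r' : Retract E B := ⟨r.i ≫ g, q, by rw [Category.assoc, ← hq, r.retract]⟩
      obtain ⟨M, ⟨e⟩⟩ := exists_iso_biprod_of_retract r'
      have hM : σ.Slice s m M := hB.of_retract
        (Retract.trans ⟨biprod.inr, biprod.snd, by simp⟩ (Retract.ofIso e.symm))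
      have hadd := height_of_isTri (σ := σ) (s := s)
        ((isTri_biprod E M).of_iso (Iso.refl _) e.symm (Iso.refl _))
      have : |σ.height s B| = |σ.height s E| + |σ.height s M| := by
        rw [hB.abs_height, hadd, mul_add, ← hE.abs_height, ← hM.abs_height]
      linarith [abs_nonneg (σ.height s M)]
    · obtain ⟨f, g, k, hT⟩ := h
      have hle : s + n + 1 ≤ s + m := by
        have : ((n + 1 : ℤ) : ℝ) ≤ m := by exact_mod_cast hlt
        push_cast at this
        linarith
      obtain ⟨q, hq⟩ : ∃ q : E ⟶ X, r.i = q ≫ f :=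
        Triangle.coyoneda_exact₂ _ hT r.i (hE.1 _ (hB.2.mono (Set.Ioi_subset_Ioi hle)) _)
      have := ih ⟨q, f ≫ r.r, by rw [← Category.assoc, ← hq, r.retract]⟩
      linarith

lemma shift_mem {φ : ℝ} {X : T} (h : σ.P φ X) (n : ℤ) : σ.P (φ + n) (X⟦n⟧) := by
  induction n using Int.induction_on with
  | zero => simpa using σ.iso_mem _ _ _ ((shiftFunctorZero T ℤ).app X).symm h
  | succ n ih =>
    have := (σ.shift _ _).1 ih
    push_cast at this ⊢
    rw [← add_assoc]
    exact σ.iso_mem _ _ _ ((shiftFunctorAdd' T (n : ℤ) 1 _ rfl).app X).symm this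
  | pred n ih =>
    have := shift_neg_one_mem ih
    push_cast at this ⊢
    rw [← add_sub_assoc]
    exact σ.iso_mem _ _ _ ((shiftFunctorAdd' T (-n : ℤ) (-1) _ rfl).app X).symm this

lemma norm_Z_shift (X : T) (n : ℤ) :
    ‖σ.Z (v (K0.mk (X⟦n⟧)))‖ = ‖σ.Z (v (K0.mk X))‖ := by
  have h1 : ∀ Y : T, ‖σ.Z (v (K0.mk (Y⟦(1 : ℤ)⟧)))‖ = ‖σ.Z (v (K0.mk Y))‖ := fun Y => by
    rw [K0.mk_shift_one, map_neg, map_neg, norm_neg]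
  induction n using Int.induction_on with
  | zero => rw [K0.mk_iso ((shiftFunctorZero T ℤ).app X)]; rfl
  | succ n ih =>
    rw [K0.mk_iso ((shiftFunctorAdd' T (n : ℤ) 1 _ rfl).app X), ← ih]
    exact h1 _
  | pred n ih =>
    have e := K0.mk_iso ((shiftFunctorAdd' T (-n - 1 : ℤ) 1 (-n) (by ring)).app X)
    rw [← ih, ← h1, e]
    rfl

lemma _root_.StabCond.IsTower.shift {p : ℕ} {A : Fin p → T} {E : T} (h : IsTower A E) (n : ℤ) :
    IsTower (fun i => (A i)⟦n⟧) (E⟦n⟧) := by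
  obtain ⟨X, h0, ⟨e⟩, hX⟩ := h
  exact ⟨fun i => (X i)⟦n⟧, (shiftFunctor T n).map_isZero h0, ⟨(shiftFunctor T n).mapIso e⟩,
    fun i => IsTri.shift (hX i) n⟩

lemma exists_isTower (σ : StabilityCondition v) (G : T) :
    ∃ (p : ℕ) (A : Fin p → T) (φ : Fin p → ℝ), (∀ i, σ.P (φ i) (A i)) ∧ IsTower A G := by
  by_cases hG : IsZero G
  · exact ⟨0, fun _ => 0, fun _ => 0, fun i => i.elim0, isTower_of_isZero _ hG⟩
  · obtain ⟨H⟩ := σ.hn G hG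
    exact ⟨_, _, _, H.mem, H.tower⟩

/-- The mass of a semistable object is bounded by a multiple of the number of shifts of `G` that
are needed to build it. -/
theorem exists_norm_Z_le_of_builtFrom [IsTriangulated T] (σ : StabilityCondition v) (G : T) :
    ∃ C : ℝ, 0 ≤ C ∧ ∀ (φ : ℝ) (E : T) (p : ℕ), σ.P φ E → BuiltFrom G p E →
      ‖σ.Z (v (K0.mk E))‖ ≤ p * C := by
  obtain ⟨q, A, ψ, hA, hG⟩ := σ.exists_isTower G
  refine ⟨∑ i, ‖σ.Z (v (K0.mk (A i)))‖, Finset.sum_nonneg fun i _ => norm_nonneg _, ?_⟩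
  rintro φ E p hE ⟨E', hE', ⟨r⟩⟩
  by_cases hE0 : IsZero E
  · rw [K0.mk_of_isZero hE0, map_zero, map_zero, norm_zero]
    positivity
  -- with respect to the heart `P((φ - 1/2, φ + 1/2])`, the height of `E` is its mass
  have hW : |σ.height (φ - 1 / 2) E| = ‖σ.Z (v (K0.mk E))‖ := by
    rw [height_of_mem hE hE0, show Real.pi * (φ - (φ - 1 / 2)) = Real.pi / 2 by ring,
      Real.sin_pi_div_two, mul_one, abs_norm]
  rw [← hW]
  have hF : ∃ n, σ.Filt (φ - 1 / 2) n E' (p * ∑ i, ‖σ.Z (v (K0.mk (A i)))‖) := by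
    clear r
    induction hE' with
    | zero hX => exact ⟨0, .zero hX (by simp)⟩
    | @step p X Y B _ hB h ih =>
      obtain ⟨n, hn⟩ := ih
      obtain ⟨k, ⟨e⟩⟩ := hB
      obtain ⟨m, hm⟩ := hn.exists_insert_of_isTower (fun i => shift_mem (hA i) k)
        (hG.shift k) (h.of_iso (Iso.refl _) (Iso.refl _) e.symm)
      have hle : ∑ i, |σ.height (φ - 1 / 2) ((A i)⟦k⟧)| ≤ ∑ i, ‖σ.Z (v (K0.mk (A i)))‖ :=
        Finset.sum_le_sum fun i _ => (abs_height_le _).trans_eq (norm_Z_shift _ _)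
      refine ⟨m, ?_⟩
      cases hm with
      | zero hX _ => exact .zero hX (by positivity)
      | step h₁ h₂ h₃ h₄ =>
        refine .step h₁ h₂ h₃ (h₄.trans ?_)
        push_cast
        linarith
  obtain ⟨n, hn⟩ := hF
  obtain ⟨m, hm⟩ := exists_slice_of_mem hE (φ - 1 / 2)
  exact hn.abs_height_le_of_retract hm r

end StabilityCondition

end Mass

/-! ### Existence of the categorical entropy -/

section EntropyExists

variable {T : Type u} [Category.{w} T] [HasZeroObject T] [HasShift T ℤ] [Preadditive T]
  [∀ n : ℤ, (shiftFunctor T n).Additive] [Pretriangulated T] [IsTriangulated T]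

lemma IsSplitGenerator.complexity_pos {G : T} (hG : IsSplitGenerator G) (E : T) :
    0 < complexity G E := (complexity_spec (hG.exists_builtFrom E)).1

lemma IsSplitGenerator.builtFrom {G : T} (hG : IsSplitGenerator G) (E : T) :
    BuiltFrom G (complexity G E) E := (complexity_spec (hG.exists_builtFrom E)).2

variable (F : T ⥤ T) [F.CommShift ℤ] [F.IsTriangulated]

lemma IsSplitGenerator.complexity_iterate_add_le {G : T} (hG : IsSplitGenerator G) (m n : ℕ) :
    complexity G (F.obj^[m + n] G) ≤
      complexity G (F.obj^[m] G) * complexity G (F.obj^[n] G) := by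
  refine complexity_le (Nat.mul_pos (hG.complexity_pos _) (hG.complexity_pos _)) ?_
  rw [Function.iterate_add_apply, mul_comm]
  exact ((hG.builtFrom (F.obj^[n] G)).iterate_map F m).trans (hG.builtFrom _)

/-- Changing the split-generator changes the complexities of the iterates of a functor by a
bounded factor only. -/
lemma IsSplitGenerator.complexity_iterate_le {G G' : T} (hG : IsSplitGenerator G)
    (hG' : IsSplitGenerator G') (n : ℕ) :
    complexity G' (F.obj^[n] G') ≤
      complexity G G' * complexity G (F.obj^[n] G) * complexity G' G := by
  refine complexity_le (Nat.mul_pos (Nat.mul_pos (hG.complexity_pos _) (hG.complexity_pos _))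
    (hG'.complexity_pos _)) ?_
  exact (((hG.builtFrom G').iterate_map F n).trans (hG.builtFrom _)).trans (hG'.builtFrom G)

lemma IsSplitGenerator.exists_tendsto {G : T} (hG : IsSplitGenerator G) :
    ∃ h : ℝ, Tendsto (fun n : ℕ => (1 / (n : ℝ)) * Real.log (complexity G (F.obj^[n] G)))
      atTop (𝓝 h) := by
  have hpos : ∀ n, (0 : ℝ) < complexity G (F.obj^[n] G) := fun n => by
    exact_mod_cast hG.complexity_pos _
  have hsub : Subadditive fun n => Real.log (complexity G (F.obj^[n] G)) := by
    intro m n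
    rw [← Real.log_mul (hpos m).ne' (hpos n).ne']
    refine Real.log_le_log (hpos _) ?_
    exact_mod_cast hG.complexity_iterate_add_le F m n
  refine ⟨hsub.lim, ?_⟩
  have := hsub.tendsto_lim ⟨0, by
    rintro _ ⟨n, rfl⟩
    exact div_nonneg (Real.log_nonneg (by exact_mod_cast hG.complexity_pos _)) n.cast_nonneg⟩
  simpa only [div_mul_eq_mul_div, one_mul] using this

lemma tendsto_const_div_natCast (K : ℝ) : Tendsto (fun n : ℕ => K / (n : ℝ)) atTop (𝓝 0) :=
  tendsto_const_nhds.div_atTop tendsto_natCast_atTop_atTop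

theorem exists_isEntropy (F : T ≌ T) [F.functor.CommShift ℤ] [F.functor.IsTriangulated]
    (hgen : ∃ G : T, IsSplitGenerator G) : ∃ h : ℝ, IsEntropy F h := by
  obtain ⟨G, hG⟩ := hgen
  obtain ⟨h, hh⟩ := hG.exists_tendsto F.functor
  refine ⟨h, fun G' hG' => ?_⟩
  set a := fun n : ℕ => Real.log (complexity G (F.functor.obj^[n] G))
  set b := fun n : ℕ => Real.log (complexity G' (F.functor.obj^[n] G'))
  have key : ∀ {G G' : T}, IsSplitGenerator G → IsSplitGenerator G' → ∀ n : ℕ,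
      Real.log (complexity G' (F.functor.obj^[n] G')) ≤
        Real.log (complexity G (F.functor.obj^[n] G)) +
          Real.log (complexity G G' * complexity G' G) := by
    intro G G' hG hG' n
    have h1 : (0 : ℝ) < complexity G (F.functor.obj^[n] G) := by
      exact_mod_cast hG.complexity_pos _
    have h2 : (0 : ℝ) < complexity G' (F.functor.obj^[n] G') := by
      exact_mod_cast hG'.complexity_pos _
    have h3 : (0 : ℝ) < complexity G G' * complexity G' G := by
      exact_mod_cast Nat.mul_pos (hG.complexity_pos _) (hG'.complexity_pos _)
    rw [← Real.log_mul h1.ne' h3.ne']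
    refine Real.log_le_log h2 ?_
    have := hG.complexity_iterate_le F.functor hG' n
    calc (complexity G' (F.functor.obj^[n] G') : ℝ)
        ≤ ((complexity G G' * complexity G (F.functor.obj^[n] G) * complexity G' G : ℕ) : ℝ) := by
          exact_mod_cast this
      _ = _ := by push_cast; ring
  set K := Real.log (complexity G G' * complexity G' G)
  have h1 := key hG hG'
  have h2 := key hG' hG
  rw [mul_comm (complexity G' G : ℝ)] at h2
  have hup : Tendsto (fun n : ℕ => 1 / (n : ℝ) * a n + K / n) atTop (𝓝 h) := by
    simpa using hh.add (tendsto_const_div_natCast K)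
  have hlo : Tendsto (fun n : ℕ => 1 / (n : ℝ) * a n - K / n) atTop (𝓝 h) := by
    simpa using hh.sub (tendsto_const_div_natCast K)
  refine tendsto_of_tendsto_of_tendsto_of_le_of_le hlo hup (fun n => ?_) (fun n => ?_)
  · have : 1 / (n : ℝ) * a n - K / n = 1 / (n : ℝ) * (a n - K) := by ring
    rw [this]
    exact mul_le_mul_of_nonneg_left (by linarith [h2 n]) (by positivity)
  · have : 1 / (n : ℝ) * a n + K / n = 1 / (n : ℝ) * (a n + K) := by ring
    rw [this]
    exact mul_le_mul_of_nonneg_left (h1 n) (by positivity)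

/-- The entropy can be bounded from below along the orbit of any object `E`: the number of shifts
of `G` needed to build `F ^ n E` exceeds `complexity G (F ^ n G)` by a bounded factor at most. -/
lemma IsEntropy.le_of_exp_le {F : T ≌ T} [F.functor.CommShift ℤ] [F.functor.IsTriangulated]
    {h : ℝ} (hF : IsEntropy F h) {G : T} (hG : IsSplitGenerator G) (E : T) {c L : ℝ}
    (hc : 0 < c) (hE : ∀ (n p : ℕ), BuiltFrom G p (F.functor.obj^[n] E) →
      c * Real.exp (n * L) ≤ p) : L ≤ h := by
  set q := complexity G E
  have hq : (0 : ℝ) < q := by exact_mod_cast hG.complexity_pos E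
  have hle : ∀ n : ℕ, Real.log (c / q) + n * L ≤
      Real.log (complexity G (F.functor.obj^[n] G)) := by
    intro n
    have h1 := hE n _ (((hG.builtFrom E).iterate_map F.functor n).trans (hG.builtFrom _))
    rw [← Real.log_exp (n * L), ← Real.log_mul (div_pos hc hq).ne' (Real.exp_pos _).ne']
    refine Real.log_le_log (mul_pos (div_pos hc hq) (Real.exp_pos _)) ?_
    rw [div_mul_eq_mul_div, div_le_iff₀ hq, mul_comm (complexity G _ : ℝ)]
    exact_mod_cast h1
  have hlim : Tendsto (fun n : ℕ => Real.log (c / q) / n + L) atTop (𝓝 L) := by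
    simpa using (tendsto_const_div_natCast (Real.log (c / q))).add_const L
  refine le_of_tendsto_of_tendsto hlim (hF G hG) ?_
  filter_upwards [eventually_gt_atTop 0] with n hn
  have hn' : (0 : ℝ) < n := by exact_mod_cast hn
  rw [show Real.log (c / q) / n + L = 1 / (n : ℝ) * (Real.log (c / q) + n * L) by field_simp]
  exact mul_le_mul_of_nonneg_left (hle n) (by positivity)

end EntropyExists

/-! ### Hyperbolic diagonal matrices -/

section Hyperbolic

/-- `diag(a, d)` is hyperbolic of determinant one with translation length `L`: one of `|a|`, `|d|`
is `exp L`, and the other one is `exp (-L)`. -/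
def IsHyperbolicPair (L a d : ℝ) : Prop :=
  a * d = 1 ∧ ((|a| = Real.exp L ∧ |d| = Real.exp (-L)) ∨
    (|a| = Real.exp (-L) ∧ |d| = Real.exp L))

lemma isHyperbolicPair_log {r : ℝ} (hr : 1 < |r|) :
    IsHyperbolicPair (Real.log |r|) r (1 / r) ∧ IsHyperbolicPair (Real.log |r|) (1 / r) r := by
  have h0 : 0 < |r| := one_pos.trans hr
  have hr0 : r ≠ 0 := abs_pos.1 h0
  have h1 : Real.exp (Real.log |r|) = |r| := Real.exp_log h0
  have h2 : Real.exp (-Real.log |r|) = |1 / r| := by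
    rw [Real.exp_neg, h1, one_div, abs_inv]
  exact ⟨⟨by field_simp, .inl ⟨h1.symm, h2.symm⟩⟩, ⟨by field_simp, .inr ⟨h2.symm, h1.symm⟩⟩⟩

lemma matAct_diag (a d : ℝ) (z : ℂ) : matAct !![a, 0; 0, d] z = ⟨a * z.re, d * z.im⟩ := by
  rw [matAct, Matrix.toLin_apply]
  apply Complex.ext <;>
    simp [Complex.coe_basisOneI_repr, Complex.coe_basisOneI, Fin.sum_univ_two, Matrix.mulVec,
      dotProduct]

lemma norm_mk_le {x y x' y' e : ℝ} (he : 0 ≤ e) (hx : |x| ≤ e * |x'|) (hy : |y| ≤ e * |y'|) :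
    ‖(⟨x, y⟩ : ℂ)‖ ≤ e * ‖(⟨x', y'⟩ : ℂ)‖ := by
  refine abs_le_of_sq_le_sq' ?_ (by positivity) |>.2
  rw [mul_pow, ← Complex.normSq_eq_norm_sq, ← Complex.normSq_eq_norm_sq, Complex.normSq_mk,
    Complex.normSq_mk]
  have h1 := mul_self_le_mul_self (abs_nonneg x) hx
  have h2 := mul_self_le_mul_self (abs_nonneg y) hy
  have e1 := abs_mul_abs_self x
  have e2 := abs_mul_abs_self y
  have e3 := abs_mul_abs_self x'
  have e4 := abs_mul_abs_self y'
  nlinarith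

variable {L a d : ℝ}

lemma IsHyperbolicPair.abs_bounds (h : IsHyperbolicPair L a d) (hL : 0 ≤ L) :
    (|a| ≤ Real.exp L ∧ Real.exp (-L) ≤ |a|) ∧ |d| ≤ Real.exp L ∧ Real.exp (-L) ≤ |d| := by
  have hle : Real.exp (-L) ≤ Real.exp L := Real.exp_le_exp.2 (by linarith)
  rcases h.2 with ⟨h1, h2⟩ | ⟨h1, h2⟩ <;> rw [h1, h2] <;> simp [hle]

lemma IsHyperbolicPair.norm_le (h : IsHyperbolicPair L a d) (hL : 0 ≤ L) (z : ℂ) :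
    ‖matAct !![a, 0; 0, d] z‖ ≤ Real.exp L * ‖z‖ := by
  obtain ⟨⟨ha, -⟩, hd, -⟩ := h.abs_bounds hL
  rw [matAct_diag]
  exact norm_mk_le (Real.exp_nonneg _)
    (by rw [abs_mul]; exact mul_le_mul_of_nonneg_right ha (abs_nonneg _))
    (by rw [abs_mul]; exact mul_le_mul_of_nonneg_right hd (abs_nonneg _))

lemma IsHyperbolicPair.le_norm (h : IsHyperbolicPair L a d) (hL : 0 ≤ L) (z : ℂ) :
    ‖z‖ ≤ Real.exp L * ‖matAct !![a, 0; 0, d] z‖ := by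
  obtain ⟨⟨-, ha⟩, -, hd⟩ := h.abs_bounds hL
  have key : ∀ {b : ℝ} (x : ℝ), Real.exp (-L) ≤ |b| → |x| ≤ Real.exp L * |b * x| := by
    intro b x hb
    rw [abs_mul, ← mul_assoc]
    refine le_mul_of_one_le_left (abs_nonneg _) ?_
    calc (1 : ℝ) = Real.exp L * Real.exp (-L) := by rw [← Real.exp_add]; simp
      _ ≤ _ := mul_le_mul_of_nonneg_left hb (Real.exp_nonneg _)
  rw [matAct_diag]
  exact norm_mk_le (x := z.re) (y := z.im) (Real.exp_nonneg _) (key _ ha) (key _ hd)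

lemma IsHyperbolicPair.abs_sub_eq (h : IsHyperbolicPair L a d) (hL : 0 ≤ L) :
    |d - a| = Real.exp L - Real.exp (-L) := by
  have hle : Real.exp (-L) ≤ Real.exp L := Real.exp_le_exp.2 (by linarith)
  have hsq : |d - a| ^ 2 = (Real.exp L - Real.exp (-L)) ^ 2 := by
    have h1 : Real.exp L * Real.exp (-L) = 1 := by rw [← Real.exp_add]; simp
    have h2 : |a| ^ 2 + |d| ^ 2 = Real.exp L ^ 2 + Real.exp (-L) ^ 2 := by
      rcases h.2 with ⟨h1, h2⟩ | ⟨h1, h2⟩ <;> rw [h1, h2]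
      rw [add_comm]
    rw [sq_abs, sq_abs] at h2
    rw [sq_abs]
    nlinarith [h.1]
  exact (sq_eq_sq₀ (abs_nonneg _) (by linarith)).1 hsq

/-- A lift `f` of the action of `diag(a, d)` on directions maps `0` and `1 / 2` to `k` and
`k + 1 / 2` for one integer `k`, so that `f p - k` and `p` are at distance at most `1 / 2`. The sine
of the angle `π (f p - k - p)` is at most `sinh L` in absolute value, which suffices for small
`L`. -/
lemma IsHyperbolicPair.exists_int_abs_sub_le (h : IsHyperbolicPair L a d) (hL : 0 ≤ L)
    (g : GLTilde) (hg : g.M = !![a, 0; 0, d]) : ∃ k : ℤ, ∀ p, |g.f p - (p + k)| ≤ L := by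
  have hcompat : ∀ p : ℝ, ∃ c : ℝ, 0 < c ∧
      a * Real.cos (Real.pi * p) = c * Real.cos (Real.pi * g.f p) ∧
      d * Real.sin (Real.pi * p) = c * Real.sin (Real.pi * g.f p) := by
    intro p
    obtain ⟨c, hc, h1⟩ := g.compat p
    have hexp : ∀ x : ℝ, Complex.exp (Complex.I * Real.pi * x) =
        Complex.exp (((Real.pi * x : ℝ) : ℂ) * Complex.I) := fun x => by
      congr 1; push_cast; ring
    rw [hg, matAct_diag, hexp, hexp] at h1
    refine ⟨c, hc, ?_, ?_⟩
    · have := congrArg Complex.re h1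
      rwa [Complex.re_ofReal_mul, Complex.exp_ofReal_mul_I_re, Complex.exp_ofReal_mul_I_re] at this
    · have := congrArg Complex.im h1
      rwa [Complex.im_ofReal_mul, Complex.exp_ofReal_mul_I_im, Complex.exp_ofReal_mul_I_im] at this
  obtain ⟨k, hk⟩ : ∃ k : ℤ, g.f 0 = k := by
    obtain ⟨c, hc, -, h2⟩ := hcompat 0
    rw [mul_zero, Real.sin_zero, mul_zero] at h2
    obtain ⟨n, hn⟩ := Real.sin_eq_zero_iff.1 ((mul_eq_zero.1 h2.symm).resolve_left hc.ne')
    exact ⟨n, mul_left_cancel₀ Real.pi_ne_zero (by rw [← hn]; ring)⟩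
  have hone : g.f 1 = k + 1 := by rw [← hk, ← g.map_add_one, zero_add]
  have hhalf : g.f (1 / 2) = k + 1 / 2 := by
    obtain ⟨c, hc, h1, -⟩ := hcompat (1 / 2)
    rw [show Real.pi * (1 / 2) = Real.pi / 2 by ring, Real.cos_pi_div_two, mul_zero] at h1
    obtain ⟨n, hn⟩ := Real.cos_eq_zero_iff.1 ((mul_eq_zero.1 h1.symm).resolve_left hc.ne')
    have hn' : g.f (1 / 2) = n + 1 / 2 :=
      mul_left_cancel₀ Real.pi_ne_zero (by rw [hn]; ring)
    have h2 := g.strictMono (show (0 : ℝ) < 1 / 2 by norm_num)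
    have h3 := g.strictMono (show (1 / 2 : ℝ) < 1 by norm_num)
    rw [hn', hk] at h2
    rw [hn', hone] at h3
    have h4 : k < n + 1 := by
      have : (k : ℝ) < n + 1 := by linarith
      exact_mod_cast this
    have h5 : n < k + 1 := by
      have : (n : ℝ) < k + 1 := by linarith
      exact_mod_cast this
    obtain rfl : n = k := by omega
    exact hn'
  -- both `p` and `f p - k` lie in the same half of the unit interval
  have hclose : ∀ p, |g.f p - (p + k)| ≤ 1 / 2 := by
    intro p
    have hfr : g.f p = g.f (Int.fract p) + ⌊p⌋ := by
      rw [← g.map_add_int, Int.fract_add_floor]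
    have hp : p = Int.fract p + ⌊p⌋ := (Int.fract_add_floor p).symm
    have h0 := Int.fract_nonneg p
    have h1 := (Int.fract_lt_one p).le
    have m0 := g.strictMono.monotone h0
    have m1 := g.strictMono.monotone h1
    rw [hk] at m0
    rw [hone] at m1
    rw [abs_le]
    rcases le_total (Int.fract p) (1 / 2) with h2 | h2
    · have m2 := g.strictMono.monotone h2
      rw [hhalf] at m2
      constructor <;> linarith
    · have m2 := g.strictMono.monotone h2
      rw [hhalf] at m2
      constructor <;> linarith
  refine ⟨k, fun p => ?_⟩
  rcases le_or_gt (1 / 2) L with hL' | hL'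
  · exact (hclose p).trans hL'
  set Δ := g.f p - (p + k)
  set D := Real.exp L - Real.exp (-L)
  have habs : |d - a| = D := h.abs_sub_eq hL
  have hD0 : 0 ≤ D := habs ▸ abs_nonneg _
  have hD : D ≤ 4 * L := by
    have h1 := Real.abs_exp_sub_one_sub_id_le (show |L| ≤ 1 by rw [abs_of_nonneg hL]; linarith)
    have h2 := Real.add_one_le_exp (-L)
    have h3 := (abs_le.1 h1).2
    simp only [D]
    nlinarith
  have hsin : |Real.sin (Real.pi * Δ)| ≤ D / 2 := by
    obtain ⟨c, hc, hcos, hsin⟩ := hcompat p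
    set x := |Real.sin (Real.pi * p) * Real.cos (Real.pi * p)|
    have hx0 : 0 ≤ x := abs_nonneg _
    have hsc := Real.sin_sq_add_cos_sq (Real.pi * p)
    have hx : 2 * x ≤ 1 := by
      have := two_mul_le_add_sq |Real.sin (Real.pi * p)| |Real.cos (Real.pi * p)|
      rw [sq_abs, sq_abs, hsc, mul_assoc, ← abs_mul] at this
      exact this
    have e1 : c * |Real.sin (Real.pi * Δ)| = D * x := by
      have hs : |Real.sin (Real.pi * Δ)| = |Real.sin (Real.pi * g.f p - Real.pi * p)| := by
        rw [show Real.pi * Δ = (Real.pi * g.f p - Real.pi * p) - k * Real.pi by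
          simp only [Δ]; ring, Real.sin_sub_int_mul_pi, abs_mul, abs_zpow, abs_neg, abs_one,
          one_zpow, one_mul]
      rw [hs, ← abs_of_pos hc, ← abs_mul, ← habs, ← abs_mul]
      congr 1
      rw [Real.sin_sub]
      linear_combination (-Real.cos (Real.pi * p)) * hsin + Real.sin (Real.pi * p) * hcos
    have e2 : 2 * x ≤ c ^ 2 := by
      have h1 : c ^ 2 = (a * Real.cos (Real.pi * p)) ^ 2 + (d * Real.sin (Real.pi * p)) ^ 2 := by
        rw [hcos, hsin]
        linear_combination (-c ^ 2) * Real.sin_sq_add_cos_sq (Real.pi * g.f p)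
      have h2 := two_mul_le_add_sq |a * Real.cos (Real.pi * p)| |d * Real.sin (Real.pi * p)|
      rw [sq_abs, sq_abs, ← h1, mul_assoc, ← abs_mul] at h2
      refine le_trans (le_of_eq ?_) h2
      simp only [x]
      congr 2
      linear_combination
        (-(Real.sin (Real.pi * p) * Real.cos (Real.pi * p))) * h.1
    rcases hx0.eq_or_lt with h0 | h0
    · rw [← h0, mul_zero] at e1
      rw [(mul_eq_zero.1 e1).resolve_left hc.ne']
      linarith
    · have h3 : (c * |Real.sin (Real.pi * Δ)|) ^ 2 = (D * x) ^ 2 := by rw [e1]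
      have h4 : x * (2 * |Real.sin (Real.pi * Δ)| ^ 2) ≤ x * (D ^ 2 * x) := by
        nlinarith [mul_le_mul_of_nonneg_right e2 (sq_nonneg |Real.sin (Real.pi * Δ)|)]
      have h5 := le_of_mul_le_mul_left h4 h0
      refine abs_le_of_sq_le_sq' ?_ (by positivity) |>.2
      nlinarith [mul_le_mul_of_nonneg_left hx (sq_nonneg D)]
  have hjordan := Real.mul_le_sin (x := Real.pi * |Δ|) (by positivity)
    (by nlinarith [hclose p, Real.pi_pos])
  have hle : Real.sin (Real.pi * |Δ|) ≤ |Real.sin (Real.pi * Δ)| := by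
    rcases abs_choice Δ with h1 | h1 <;> rw [h1]
    · exact le_abs_self _
    · rw [mul_neg, Real.sin_neg]
      exact neg_le_abs _
  have : 2 / Real.pi * (Real.pi * |Δ|) = 2 * |Δ| := by
    field_simp
  linarith

end Hyperbolic

/-! ### Discreteness of the lattice and the support property -/

section Support

/-- A linear functional on a finite-dimensional space is bounded with respect to every norm. -/
lemma exists_abs_le_mul_seminorm {V : Type*} [AddCommGroup V] [Module ℝ V]
    [FiniteDimensional ℝ V] (N : Seminorm ℝ V) (hN : ∀ x, N x = 0 → x = 0) (l : V →ₗ[ℝ] ℝ) :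
    ∃ C : ℝ, 0 < C ∧ ∀ x, |l x| ≤ C * N x := by
  let n : AddGroupNorm V :=
    { toFun := N
      map_zero' := map_zero N
      add_le' := map_add_le_add N
      neg' := map_neg_eq_map N
      eq_zero_of_map_eq_zero' := hN }
  let _ : NormedAddCommGroup V := n.toNormedAddCommGroup
  let _ : NormedSpace ℝ V := ⟨fun a x => (map_smul_eq_mul N a x).le⟩
  obtain ⟨C, hC, h⟩ := (LinearMap.toContinuousLinearMap l).bound
  exact ⟨C, hC, h⟩

/-- The nonzero elements of a lattice are bounded away from zero. -/
lemma exists_le_seminorm_of_ne_zero {Λ : Type*} [AddCommGroup Λ] [Module.Free ℤ Λ]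
    [Module.Finite ℤ Λ] (N : Seminorm ℝ (ℝ ⊗[ℤ] Λ)) (hN : ∀ x, N x = 0 → x = 0) :
    ∃ c : ℝ, 0 < c ∧ ∀ x : Λ, x ≠ 0 → c ≤ N ((1 : ℝ) ⊗ₜ[ℤ] x) := by
  classical
  let b := Module.Free.chooseBasis ℤ Λ
  let b' := Algebra.TensorProduct.basis ℝ b
  choose C hC h using fun i => exists_abs_le_mul_seminorm N hN (b'.coord i)
  have hS : 0 ≤ ∑ i, C i := Finset.sum_nonneg fun i _ => (hC i).le
  refine ⟨1 / (∑ i, C i + 1), by positivity, fun x hx => ?_⟩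
  obtain ⟨i, hi⟩ : ∃ i, b.repr x i ≠ 0 := by
    by_contra hall
    push Not at hall
    exact hx (b.repr.map_eq_zero_iff.1 (Finsupp.ext hall))
  have h1 : b'.coord i ((1 : ℝ) ⊗ₜ[ℤ] x) = (b.repr x i : ℝ) := by
    simp [b', Algebra.TensorProduct.basis_repr_tmul]
  have h2 := h i ((1 : ℝ) ⊗ₜ[ℤ] x)
  rw [h1] at h2
  have h3 : (1 : ℝ) ≤ |(b.repr x i : ℝ)| := by
    exact_mod_cast Int.one_le_abs hi
  have h4 : C i ≤ ∑ i, C i + 1 :=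
    (Finset.single_le_sum (fun i _ => (hC i).le) (Finset.mem_univ i)).trans (by linarith)
  rw [div_le_iff₀ (by positivity), mul_comm]
  exact (h3.trans h2).trans (mul_le_mul_of_nonneg_right h4 (apply_nonneg N _))

end Support

section Actions

variable {T : Type u} [Category.{w} T] [HasZeroObject T] [HasShift T ℤ] [Preadditive T]
  [∀ n : ℤ, (shiftFunctor T n).Additive] [Pretriangulated T]
  {Λ : Type*} [AddCommGroup Λ] {v : K0 T →+ Λ}

namespace StabilityCondition

/-- The masses of the semistable objects are bounded away from zero. -/
lemma exists_le_norm_Z [Module.Free ℤ Λ] [Module.Finite ℤ Λ] (σ : StabilityCondition v) :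
    ∃ ε : ℝ, 0 < ε ∧ ∀ (φ : ℝ) (E : T), σ.P φ E → ¬ IsZero E →
      ε ≤ ‖σ.Z (v (K0.mk E))‖ := by
  obtain ⟨N, hN, C, hC, h⟩ := σ.support
  obtain ⟨c, hc, hc'⟩ := exists_le_seminorm_of_ne_zero N hN
  refine ⟨c / C, div_pos hc hC, fun φ E hE hE0 => ?_⟩
  rw [div_le_iff₀ hC, mul_comm]
  refine (hc' _ fun h0 => σ.Z_ne_zero hE hE0 ?_).trans (h φ E hE hE0).le
  rw [h0, map_zero]

/-! ### Masses and phases under the group actions -/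

section CAct

variable [IsTriangulated T] (σ : StabilityCondition v) (E : T) (hE : ¬ IsZero E) (z : ℂ)

/-- A Harder--Narasimhan filtration for `σ`, as one for `σ.cAct z`. -/
noncomputable def hnfCAct : HNFiltration (σ.cAct z).P E where
  len := (σ.hnf E hE).len
  phase i := (σ.hnf E hE).phase i - z.re
  factor := (σ.hnf E hE).factor
  strictAnti _ _ hij := sub_lt_sub_right ((σ.hnf E hE).strictAnti hij) _
  mem i := by
    change σ.P ((σ.hnf E hE).phase i - z.re + z.re) _
    rw [sub_add_cancel]
    exact (σ.hnf E hE).mem i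
  nonzero := (σ.hnf E hE).nonzero
  tower := (σ.hnf E hE).tower

lemma phiPlus_cAct : (σ.cAct z).phiPlus E hE = σ.phiPlus E hE - z.re :=
  phiPlus_eq hE (σ.hnfCAct E hE z)

omit [IsTriangulated T] in
lemma phiMinus_cAct : (σ.cAct z).phiMinus E hE = σ.phiMinus E hE - z.re :=
  phiMinus_eq hE (σ.hnfCAct E hE z)

lemma mass_cAct : (σ.cAct z).mass E hE = Real.exp (Real.pi * z.im) * σ.mass E hE := by
  rw [mass_eq hE (σ.hnfCAct E hE z), mass, Finset.mul_sum]
  refine Finset.sum_congr rfl fun i _ => ?_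
  change ‖Complex.exp (-(Complex.I * Real.pi * z)) * σ.Z _‖ = _
  rw [norm_mul, Complex.norm_exp]
  congr 2
  simp

end CAct

section GLAct

variable [IsTriangulated T] (σ : StabilityCondition v) (E : T) (hE : ¬ IsZero E) (g : GLTilde)

/-- A Harder--Narasimhan filtration for `σ`, as one for `σ.glAct g`. -/
noncomputable def hnfGLAct : HNFiltration (σ.glAct g).P E where
  len := (σ.hnf E hE).len
  phase i := (g.surjective ((σ.hnf E hE).phase i)).choose
  factor := (σ.hnf E hE).factor
  strictAnti i j hij := by
    rw [← g.strictMono.lt_iff_lt, (g.surjective _).choose_spec, (g.surjective _).choose_spec]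
    exact (σ.hnf E hE).strictAnti hij
  mem i := by
    change σ.P (g.f _) _
    rw [(g.surjective _).choose_spec]
    exact (σ.hnf E hE).mem i
  nonzero := (σ.hnf E hE).nonzero
  tower := (σ.hnf E hE).tower

lemma f_phiPlus_glAct : g.f ((σ.glAct g).phiPlus E hE) = σ.phiPlus E hE := by
  rw [phiPlus_eq hE (σ.hnfGLAct E hE g)]
  exact (g.surjective _).choose_spec

omit [IsTriangulated T] in
lemma f_phiMinus_glAct : g.f ((σ.glAct g).phiMinus E hE) = σ.phiMinus E hE := by
  rw [phiMinus_eq hE (σ.hnfGLAct E hE g)]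
  exact (g.surjective _).choose_spec

lemma mass_glAct : (σ.glAct g).mass E hE =
    ∑ i, ‖matAct g.M⁻¹ (σ.Z (v (K0.mk ((σ.hnf E hE).factor i))))‖ :=
  mass_eq hE (σ.hnfGLAct E hE g)

end GLAct

section AutAct

variable (F : T ≌ T) [F.functor.CommShift ℤ] [F.functor.IsTriangulated]
  {α : Λ ≃+ Λ} (hα : InducesOn v F α) (σ : StabilityCondition v)

lemma _root_.StabCond.not_isZero_functor_obj {E : T} (hE : ¬ IsZero E) :
    ¬ IsZero (F.functor.obj E) := by
  intro h
  rw [IsZero.iff_id_eq_zero] at h hE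
  exact hE (F.functor.map_injective (by simpa using h))

lemma _root_.StabCond.not_isZero_iterate_functor_obj {E : T} (hE : ¬ IsZero E) (n : ℕ) :
    ¬ IsZero (F.functor.obj^[n] E) := by
  induction n with
  | zero => exact hE
  | succ n ih =>
    rw [Function.iterate_succ_apply']
    exact not_isZero_functor_obj F ih

/-- The image under `F` of a Harder--Narasimhan filtration for `σ`. -/
noncomputable def hnfAutAct {E : T} (hE : ¬ IsZero E) :
    HNFiltration (σ.autAct F α hα).P (F.functor.obj E) where
  len := (σ.hnf E hE).len
  phase := (σ.hnf E hE).phase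
  factor i := F.functor.obj ((σ.hnf E hE).factor i)
  strictAnti := (σ.hnf E hE).strictAnti
  mem i := ⟨_, (σ.hnf E hE).mem i, ⟨Iso.refl _⟩⟩
  nonzero i := not_isZero_functor_obj F ((σ.hnf E hE).nonzero i)
  tower := (σ.hnf E hE).tower.map F.functor

lemma mass_autAct [IsTriangulated T] {E : T} (hE : ¬ IsZero E)
    (hE' : ¬ IsZero (F.functor.obj E)) :
    (σ.autAct F α hα).mass _ hE' = σ.mass E hE := by
  rw [mass_eq _ (σ.hnfAutAct F hα hE), mass]
  refine Finset.sum_congr rfl fun i _ => ?_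
  change ‖σ.Z (α.symm (v (K0.mk (F.functor.obj _))))‖ = _
  rw [← K0.map_mk, hα, AddEquiv.symm_apply_apply]

end AutAct

/-! ### Stability conditions with comparable masses -/

/-- The logarithms of the masses of every object with respect to `σ` and `τ` differ by at most
`D`. -/
def MassBound (D : ℝ) (σ τ : StabilityCondition v) : Prop :=
  ∀ (E : T) (hE : ¬ IsZero E), |Real.log (σ.mass E hE) - Real.log (τ.mass E hE)| ≤ D

lemma MassBound.symm {D : ℝ} {σ τ : StabilityCondition v} (h : MassBound D σ τ) :
    MassBound D τ σ := fun E hE => by rw [abs_sub_comm]; exact h E hE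

lemma MassBound.trans {D D' : ℝ} {σ τ ρ : StabilityCondition v} (h : MassBound D σ τ)
    (h' : MassBound D' τ ρ) : MassBound (D + D') σ ρ :=
  fun E hE => (abs_sub_le _ _ _).trans (add_le_add (h E hE) (h' E hE))

lemma massBound_of_dB_le {D : ℝ} (hD : 0 ≤ D) {σ τ : StabilityCondition v}
    (h : dB σ τ ≤ ENNReal.ofReal D) : MassBound D σ τ := by
  intro E hE
  have h1 := ((le_max_right _ _).trans (le_iSup₂ (f := fun (E : T) (hE : ¬ IsZero E) =>
    max (max (ENNReal.ofReal |σ.phiPlus E hE - τ.phiPlus E hE|)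
        (ENNReal.ofReal |σ.phiMinus E hE - τ.phiMinus E hE|))
      (ENNReal.ofReal |Real.log (σ.mass E hE / τ.mass E hE)|)) E hE)).trans h
  rw [ENNReal.ofReal_le_ofReal_iff hD,
    Real.log_div (σ.mass_pos E hE).ne' (τ.mass_pos E hE).ne'] at h1
  exact h1

lemma isClopen_setOf_massBound (σ : StabilityCondition v) :
    IsClopen {τ | ∃ D, MassBound D σ τ} := by
  constructor
  · rw [← isOpen_compl_iff]
    refine fun τ hτ => ⟨1, one_pos, fun ρ hρ => ?_⟩
    rintro ⟨D, hD⟩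
    exact hτ ⟨_, hD.trans (massBound_of_dB_le zero_le_one hρ.le).symm⟩
  · rintro τ ⟨D, hD⟩
    exact ⟨1, one_pos, fun ρ hρ => ⟨_, hD.trans (massBound_of_dB_le zero_le_one hρ.le)⟩⟩

lemma exists_massBound_of_mem_connectedComponent {σ₀ σ τ : StabilityCondition v}
    (hσ : σ ∈ connectedComponent σ₀) (hτ : τ ∈ connectedComponent σ₀) :
    ∃ D, MassBound D σ τ := by
  have h : connectedComponent σ₀ ⊆ {τ | ∃ D, MassBound D σ₀ τ} :=
    (isClopen_setOf_massBound σ₀).connectedComponent_subset ⟨0, fun E hE => by simp⟩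
  obtain ⟨D, hD⟩ := h hσ
  obtain ⟨D', hD'⟩ := h hτ
  exact ⟨_, hD.symm.trans hD'⟩

end StabilityCondition

end Actions

/-! ### Semistable objects of a pseudo-Anosov autoequivalence -/

section PseudoAnosov

variable {T : Type u} [Category.{w} T] [HasZeroObject T] [HasShift T ℤ] [Preadditive T]
  [∀ n : ℤ, (shiftFunctor T n).Additive] [Pretriangulated T]
  {Λ : Type*} [AddCommGroup Λ] {v : K0 T →+ Λ}

namespace StabilityCondition

section Fixed

variable {F : T ≌ T} [F.functor.CommShift ℤ] [F.functor.IsTriangulated]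
  {α : Λ ≃+ Λ} {hα : InducesOn v F α} {σ : StabilityCondition v} {g : GLTilde}
  (hσ : σ.autAct F α hα = σ.glAct g)

include hσ

lemma Z_functor_obj (E : T) :
    σ.Z (v (K0.mk (F.functor.obj E))) = matAct g.M (σ.Z (v (K0.mk E))) := by
  have h : σ.Z (α.symm (α (v (K0.mk E)))) = matAct g.M⁻¹ (σ.Z (α (v (K0.mk E)))) :=
    DFunLike.congr_fun (congrArg StabilityCondition.Z hσ) (α (v (K0.mk E)))
  rw [AddEquiv.symm_apply_apply] at h
  rw [← K0.map_mk, hα, h, g.matAct_inv_right]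

lemma Z_iterate_functor_obj {a d : ℝ} (hg : g.M = !![a, 0; 0, d]) (E : T) (n : ℕ) :
    σ.Z (v (K0.mk (F.functor.obj^[n] E))) =
      ⟨a ^ n * (σ.Z (v (K0.mk E))).re, d ^ n * (σ.Z (v (K0.mk E))).im⟩ := by
  induction n with
  | zero => simp
  | succ n ih =>
    rw [Function.iterate_succ_apply', Z_functor_obj hσ, ih, hg, matAct_diag]
    apply Complex.ext <;> simp only <;> ring

lemma mem_functor_obj {φ : ℝ} {E : T} (h : σ.P φ E) :
    ∃ ψ, σ.P ψ (F.functor.obj E) := by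
  have hP : (σ.P φ).map F.functor = σ.P (g.f φ) :=
    congrFun (congrArg StabilityCondition.P hσ) φ
  refine ⟨g.f φ, ?_⟩
  rw [← hP]
  exact ⟨_, h, ⟨Iso.refl _⟩⟩

lemma mem_iterate_functor_obj {φ : ℝ} {E : T} (h : σ.P φ E) (n : ℕ) :
    ∃ ψ, σ.P ψ (F.functor.obj^[n] E) := by
  induction n with
  | zero => exact ⟨φ, h⟩
  | succ n ih =>
    obtain ⟨ψ, hψ⟩ := ih
    rw [Function.iterate_succ_apply']
    exact mem_functor_obj hσ hψ

/-- Every semistable object is the image of a semistable object under `F ^ n`. -/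
lemma exists_iterate_functor_obj_iso {φ : ℝ} {E : T} (h : σ.P φ E) (n : ℕ) :
    ∃ ψ A, σ.P ψ A ∧ Nonempty (F.functor.obj^[n] A ≅ E) := by
  induction n generalizing φ E with
  | zero => exact ⟨φ, E, h, ⟨Iso.refl _⟩⟩
  | succ n ih =>
    obtain ⟨ψ, rfl⟩ := g.surjective φ
    have hP : (σ.P ψ).map F.functor = σ.P (g.f ψ) :=
      congrFun (congrArg StabilityCondition.P hσ) ψ
    rw [← hP] at h
    obtain ⟨B, hB, ⟨i⟩⟩ := h
    obtain ⟨χ, A, hA, ⟨j⟩⟩ := ih hB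
    refine ⟨χ, A, hA, ⟨?_⟩⟩
    rw [Function.iterate_succ_apply']
    exact F.functor.mapIso j ≪≫ i

end Fixed

section Growth

variable [Module.Free ℤ Λ] [Module.Finite ℤ Λ]
  {F : T ≌ T} [F.functor.CommShift ℤ] [F.functor.IsTriangulated]
  {α : Λ ≃+ Λ} {hα : InducesOn v F α} {σ : StabilityCondition v} {g : GLTilde}
  (hσ : σ.autAct F α hα = σ.glAct g) {L a d : ℝ} (hL : 0 < L) (had : IsHyperbolicPair L a d)
  (hg : g.M = !![a, 0; 0, d])

include hσ hL had hg

/-- The central charge of a semistable object lies on no eigenline of `M`: otherwise the central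
charges of its images under `F ^ n` would tend to zero for `n → ∞` or for `n → -∞`, while the
images stay semistable. -/
lemma re_ne_zero_and_im_ne_zero {φ : ℝ} {E : T} (h : σ.P φ E) (hE : ¬ IsZero E) :
    (σ.Z (v (K0.mk E))).re ≠ 0 ∧ (σ.Z (v (K0.mk E))).im ≠ 0 := by
  obtain ⟨ε, hε, hlow⟩ := σ.exists_le_norm_Z
  have hfwd : ∀ n : ℕ, ε ≤
      |a| ^ n * |(σ.Z (v (K0.mk E))).re| + |d| ^ n * |(σ.Z (v (K0.mk E))).im| := by
    intro n
    obtain ⟨ψ, hψ⟩ := mem_iterate_functor_obj hσ h n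
    refine (hlow ψ _ hψ (not_isZero_iterate_functor_obj F hE n)).trans ?_
    rw [Z_iterate_functor_obj hσ hg]
    refine (Complex.norm_le_abs_re_add_abs_im _).trans_eq ?_
    simp only [abs_mul, abs_pow]
  have ha0 : a ≠ 0 := left_ne_zero_of_mul_eq_one had.1
  have hd0 : d ≠ 0 := right_ne_zero_of_mul_eq_one had.1
  have hbwd : ∀ n : ℕ, ε ≤
      |(σ.Z (v (K0.mk E))).re| / |a| ^ n + |(σ.Z (v (K0.mk E))).im| / |d| ^ n := by
    intro n
    obtain ⟨ψ, A, hA, ⟨e⟩⟩ := exists_iterate_functor_obj_iso hσ h n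
    have hA0 : ¬ IsZero A := by
      intro hA0
      refine hE (IsZero.of_iso ?_ e.symm)
      clear e
      induction n with
      | zero => exact hA0
      | succ n ih =>
        rw [Function.iterate_succ_apply']
        exact F.functor.map_isZero ih
    have hZ := Z_iterate_functor_obj hσ hg A n
    rw [K0.mk_iso e] at hZ
    refine (hlow ψ _ hA hA0).trans ((Complex.norm_le_abs_re_add_abs_im _).trans_eq ?_)
    rw [hZ]
    simp only [abs_mul, abs_pow]
    field_simp
  have hexp : Tendsto (fun n : ℕ => Real.exp (-L) ^ n) atTop (𝓝 0) :=
    tendsto_pow_atTop_nhds_zero_of_lt_one (Real.exp_nonneg _)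
      ((Real.exp_lt_exp.2 (neg_lt_zero.2 hL)).trans_eq Real.exp_zero)
  have hcontra : ∀ x : ℝ, ¬ ∀ n : ℕ, ε ≤ Real.exp (-L) ^ n * x := by
    intro x hx
    have h0 : Tendsto (fun n : ℕ => Real.exp (-L) ^ n * x) atTop (𝓝 0) := by
      simpa using hexp.mul_const x
    exact hε.not_ge (ge_of_tendsto' h0 hx)
  have hdiv : ∀ (x : ℝ) (n : ℕ), x / Real.exp L ^ n = Real.exp (-L) ^ n * x := by
    intro x n
    rw [Real.exp_neg, inv_pow, div_eq_inv_mul]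
  constructor <;> intro h0 <;> rw [h0, abs_zero] at hfwd hbwd <;>
    simp only [mul_zero, zero_div, add_zero, zero_add] at hfwd hbwd
  · rcases had.2 with ⟨-, h1⟩ | ⟨-, h1⟩ <;> rw [h1] at hfwd hbwd
    · exact hcontra _ hfwd
    · simp only [hdiv] at hbwd
      exact hcontra _ hbwd
  · rcases had.2 with ⟨h1, -⟩ | ⟨h1, -⟩ <;> rw [h1] at hfwd hbwd
    · simp only [hdiv] at hbwd
      exact hcontra _ hbwd
    · exact hcontra _ hfwd

/-- The mass of a semistable object grows exponentially under the iteration of `F` and of its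
inverse. -/
lemma exists_exp_le_norm_Z {φ : ℝ} {E : T} (h : σ.P φ E) (hE : ¬ IsZero E) :
    ∃ κ : ℝ, 0 < κ ∧ ∀ n : ℕ,
      κ * Real.exp (n * L) ≤ ‖σ.Z (v (K0.mk (F.functor.obj^[n] E)))‖ ∧
      ∀ A : T, Nonempty (F.functor.obj^[n] A ≅ E) →
        κ * Real.exp (n * L) ≤ ‖σ.Z (v (K0.mk A))‖ := by
  obtain ⟨hre, him⟩ := re_ne_zero_and_im_ne_zero hσ hL had hg h hE
  set x := (σ.Z (v (K0.mk E))).re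
  set y := (σ.Z (v (K0.mk E))).im
  have hκx : min |x| |y| ≤ |x| := min_le_left _ _
  have hκy : min |x| |y| ≤ |y| := min_le_right _ _
  have hpow : ∀ n : ℕ, Real.exp (n * L) = Real.exp L ^ n := fun n => Real.exp_nat_mul L n
  have hinv : ∀ n : ℕ, Real.exp L ^ n * Real.exp (-L) ^ n = 1 := fun n => by
    rw [← mul_pow, ← Real.exp_add, add_neg_cancel, Real.exp_zero, one_pow]
  refine ⟨min |x| |y|, lt_min (abs_pos.2 hre) (abs_pos.2 him), fun n => ⟨?_, ?_⟩⟩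
  · rw [Z_iterate_functor_obj hσ hg, hpow, mul_comm]
    rcases had.2 with ⟨h1, -⟩ | ⟨-, h1⟩
    · refine le_trans ?_ (Complex.abs_re_le_norm _)
      rw [abs_mul, abs_pow, h1]
      gcongr
    · refine le_trans ?_ (Complex.abs_im_le_norm _)
      rw [abs_mul, abs_pow, h1]
      gcongr
  · rintro A ⟨e⟩
    have hZ := Z_iterate_functor_obj hσ hg A n
    rw [K0.mk_iso e] at hZ
    have hx : |x| = |a| ^ n * |(σ.Z (v (K0.mk A))).re| := by
      simp only [x, hZ, abs_mul, abs_pow]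
    have hy : |y| = |d| ^ n * |(σ.Z (v (K0.mk A))).im| := by
      simp only [y, hZ, abs_mul, abs_pow]
    rw [hpow, mul_comm]
    rcases had.2 with ⟨-, h1⟩ | ⟨h1, -⟩
    · refine le_trans ?_ (Complex.abs_im_le_norm _)
      refine (mul_le_mul_of_nonneg_left hκy (by positivity)).trans_eq ?_
      rw [hy, h1, ← mul_assoc, hinv, one_mul]
    · refine le_trans ?_ (Complex.abs_re_le_norm _)
      refine (mul_le_mul_of_nonneg_left hκx (by positivity)).trans_eq ?_
      rw [hx, h1, ← mul_assoc, hinv, one_mul]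

variable [IsTriangulated T]

/-- The entropy of `F` is at least the exponential growth rate of the masses of semistable
objects. -/
lemma le_of_isEntropy (hne : ∃ E : T, ¬ IsZero E) (hgen : ∃ G : T, IsSplitGenerator G) {h : ℝ}
    (hF : IsEntropy F h) : L ≤ h := by
  obtain ⟨E, hE⟩ := hne
  obtain ⟨G, hG⟩ := hgen
  obtain ⟨H⟩ := σ.hn E hE
  obtain ⟨κ, hκ, hgrow⟩ := exists_exp_le_norm_Z hσ hL had hg (H.mem 0) (H.nonzero 0)
  obtain ⟨C, hC, hmass⟩ := σ.exists_norm_Z_le_of_builtFrom G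
  refine hF.le_of_exp_le hG (H.factor 0) (c := κ / (C + 1)) (by positivity) fun n p hp => ?_
  obtain ⟨ψ, hψ⟩ := mem_iterate_functor_obj hσ (H.mem 0) n
  rw [div_mul_eq_mul_div, div_le_iff₀ (by positivity)]
  have hp0 : (0 : ℝ) ≤ p := p.cast_nonneg
  calc κ * Real.exp (n * L) ≤ p * C := (hgrow n).1.trans (hmass ψ _ p hψ hp)
    _ ≤ p * (C + 1) := by nlinarith

/-- Every point of the component of `σ` is moved by at least `L` in the quotient metric. -/
lemma le_dBbar {σ₀ τ : StabilityCondition v} (hne : ∃ E : T, ¬ IsZero E)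
    (hσ₀ : σ ∈ connectedComponent σ₀) (hτ : τ ∈ connectedComponent σ₀) :
    ENNReal.ofReal L ≤ dBbar τ (τ.autAct F α hα) := by
  refine le_iInf fun z => le_of_not_gt fun hlt => ?_
  set d' := (dB τ ((τ.autAct F α hα).cAct z)).toReal with hd'
  have hd0 : 0 ≤ d' := ENNReal.toReal_nonneg
  have hfin : dB τ ((τ.autAct F α hα).cAct z) ≠ ⊤ := ne_top_of_lt hlt
  have hdL : d' < L := by
    rwa [← ENNReal.ofReal_toReal hfin, ← hd', ENNReal.ofReal_lt_ofReal_iff hL] at hlt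
  have hstep := massBound_of_dB_le hd0 (ENNReal.ofReal_toReal hfin).symm.le
  -- up to the constant `c`, applying `F` changes the logarithm of a mass by at most `d'`
  set c := Real.pi * z.im
  have hstep' : ∀ (E : T) (hE : ¬ IsZero E) (hE' : ¬ IsZero (F.functor.obj E)),
      |Real.log (τ.mass _ hE') - (Real.log (τ.mass E hE) + c)| ≤ d' := by
    intro E hE hE'
    have := hstep _ hE'
    rwa [mass_cAct, mass_autAct F hα τ hE, Real.log_mul (Real.exp_pos _).ne'
      (τ.mass_pos E hE).ne', Real.log_exp, add_comm] at this
  have hiter : ∀ (E : T) (hE : ¬ IsZero E) (n : ℕ),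
      |Real.log (τ.mass _ (not_isZero_iterate_functor_obj F hE n)) -
        (Real.log (τ.mass E hE) + n * c)| ≤ n * d' := by
    intro E hE n
    induction n with
    | zero => simp
    | succ n ih =>
      have h1 := hstep' _ (not_isZero_iterate_functor_obj F hE n)
        (not_isZero_functor_obj F (not_isZero_iterate_functor_obj F hE n))
      have h2 : τ.mass _ (not_isZero_iterate_functor_obj F hE (n + 1)) = τ.mass _
          (not_isZero_functor_obj F (not_isZero_iterate_functor_obj F hE n)) :=
        mass_iso (eqToIso (Function.iterate_succ_apply' _ _ _)) _ _
      rw [h2]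
      push_cast
      rw [abs_le] at *
      constructor <;> linarith [h1.1, h1.2, ih.1, ih.2]
  obtain ⟨D, hD⟩ := exists_massBound_of_mem_connectedComponent hσ₀ hτ
  obtain ⟨E', hE'⟩ := hne
  obtain ⟨H⟩ := σ.hn E' hE'
  set E := H.factor 0
  have hE := H.nonzero 0
  obtain ⟨κ, hκ, hgrow⟩ := exists_exp_le_norm_Z hσ hL had hg (H.mem 0) hE
  have hlog : ∀ {n : ℕ} {x : ℝ}, κ * Real.exp (n * L) ≤ x →
      Real.log κ + n * L ≤ Real.log x := by
    intro n x hx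
    rw [← Real.log_exp (n * L), ← Real.log_mul hκ.ne' (Real.exp_pos _).ne']
    exact Real.log_le_log (by positivity) hx
  have key : ∀ n : ℕ, n * (L - d') ≤ Real.log (τ.mass E hE) + D - Real.log κ := by
    intro n
    obtain ⟨ψ, hψ⟩ := mem_iterate_functor_obj hσ (H.mem 0) n
    obtain ⟨χ, A, hA, ⟨e⟩⟩ := exists_iterate_functor_obj_iso hσ (H.mem 0) n
    have hA0 : ¬ IsZero A := by
      intro h0
      have := (hgrow n).2 A ⟨e⟩
      rw [K0.mk_of_isZero h0, map_zero, map_zero, norm_zero] at this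
      have := mul_pos hκ (Real.exp_pos (n * L))
      linarith
    have hn := not_isZero_iterate_functor_obj F hE n
    have h1 := hlog (hgrow n).1
    rw [← mass_of_mem hψ hn] at h1
    have h2 := hlog ((hgrow n).2 A ⟨e⟩)
    rw [← mass_of_mem hA hA0] at h2
    have h3 := (abs_le.1 (hD _ hn)).2
    have h4 := (abs_le.1 (hD A hA0)).2
    have h5 := (abs_le.1 (hiter E hE n)).2
    have h6 := (abs_le.1 (hiter A hA0 n)).1
    rw [mass_iso e _ hE] at h6
    linarith
  obtain ⟨n, hn⟩ := exists_nat_gt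
    ((Real.log (τ.mass E hE) + D - Real.log κ) / (L - d'))
  rw [div_lt_iff₀ (by linarith)] at hn
  exact (key n).not_gt hn

omit hL hσ [Module.Free ℤ Λ] [Module.Finite ℤ Λ] in
/-- The point `σ` is moved by at most `L` in the quotient metric. -/
lemma dBbar_glAct_le (hL : 0 ≤ L) : dBbar σ (σ.glAct g) ≤ ENNReal.ofReal L := by
  obtain ⟨k, hk⟩ := had.exists_int_abs_sub_le hL g hg
  refine (iInf_le _ (-(k : ℂ))).trans (iSup₂_le fun E hE => max_le (max_le ?_ ?_) ?_) <;>
    refine ENNReal.ofReal_le_ofReal ?_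
  · rw [phiPlus_cAct]
    simpa [f_phiPlus_glAct] using hk ((σ.glAct g).phiPlus E hE)
  · rw [phiMinus_cAct]
    simpa [f_phiMinus_glAct] using hk ((σ.glAct g).phiMinus E hE)
  · have hm := σ.mass_pos E hE
    have hm' := (σ.glAct g).mass_pos E hE
    have hc : ((σ.glAct g).cAct (-(k : ℂ))).mass E hE = (σ.glAct g).mass E hE := by
      rw [mass_cAct]
      simp
    have hM : ∀ w : ℂ, matAct !![a, 0; 0, d] (matAct g.M⁻¹ w) = w := fun w => by
      rw [← hg, g.matAct_inv_right]
    have h1 : σ.mass E hE ≤ Real.exp L * (σ.glAct g).mass E hE := by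
      rw [mass_glAct, mass, Finset.mul_sum]
      refine Finset.sum_le_sum fun i _ => ?_
      have := had.norm_le hL (matAct g.M⁻¹ (σ.Z (v (K0.mk ((σ.hnf E hE).factor i)))))
      rwa [hM] at this
    have h2 : (σ.glAct g).mass E hE ≤ Real.exp L * σ.mass E hE := by
      rw [mass_glAct, mass, Finset.mul_sum]
      refine Finset.sum_le_sum fun i _ => ?_
      have := had.le_norm hL (matAct g.M⁻¹ (σ.Z (v (K0.mk ((σ.hnf E hE).factor i)))))
      rwa [hM] at this
    rw [hc, Real.log_div hm.ne' hm'.ne', abs_le]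
    have h3 := Real.log_le_log hm h1
    have h4 := Real.log_le_log hm' h2
    rw [Real.log_mul (Real.exp_pos _).ne' hm'.ne', Real.log_exp] at h3
    rw [Real.log_mul (Real.exp_pos _).ne' hm.ne', Real.log_exp] at h4
    constructor <;> linarith

end Growth

end StabilityCondition

end PseudoAnosov
end StabCond

theorem corollary4p9
    -- a nonzero triangulated category of finite type over a field, with a split-generator
    {k : Type*} [Field k] {T : Type u} [Category.{w} T] [HasZeroObject T] [HasShift T ℤ]
    [Preadditive T] [∀ n : ℤ, (shiftFunctor T n).Additive] [Pretriangulated T] [IsTriangulated T]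
    [Linear k T] [∀ n : ℤ, (shiftFunctor T n).Linear k]
    (hfin : IsFiniteType T k) (hne : ∃ E : T, ¬ IsZero E) (hgen : ∃ G : T, IsSplitGenerator G)
    -- a finitely generated free quotient of the Grothendieck group
    {Λ : Type*} [AddCommGroup Λ] [Module.Free ℤ Λ] [Module.Finite ℤ Λ]
    (v : K0 T →+ Λ) (hv : Function.Surjective v)
    -- a connected component of the space of stability conditions
    (S : Set (StabilityCondition v)) (hS : ∃ σ₀, S = connectedComponent σ₀)
    -- an exact autoequivalence, compatible with `v`, and pseudo-Anosov
    (F : T ≌ T) [F.functor.CommShift ℤ] [F.functor.IsTriangulated]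
    (α : Λ ≃+ Λ) (hα : InducesOn v F α) (hF : IsPseudoAnosov F α hα S) :
    ∃ h : ℝ, IsEntropy F h ∧ translationLength F α hα S ≤ ENNReal.ofReal h ∧
      0 < translationLength F α hα S := by
  obtain ⟨σ₀, rfl⟩ := hS
  obtain ⟨σ, hσS, g, r, hr, hM, hσ⟩ := hF
  obtain ⟨a, d, had, hg⟩ : ∃ a d : ℝ, IsHyperbolicPair (Real.log |r|) a d ∧
      g.M = !![a, 0; 0, d] := by
    rcases hM with hM | hM
    · exact ⟨_, _, (isHyperbolicPair_log hr).2, hM⟩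
    · exact ⟨_, _, (isHyperbolicPair_log hr).1, hM⟩
  have hL : 0 < Real.log |r| := Real.log_pos hr
  obtain ⟨h, hh⟩ := exists_isEntropy F hgen
  refine ⟨h, hh, ?_, ?_⟩
  · calc translationLength F α hα (connectedComponent σ₀)
        ≤ StabilityCondition.dBbar σ (σ.autAct F α hα) := iInf₂_le σ hσS
      _ = StabilityCondition.dBbar σ (σ.glAct g) := by rw [hσ]
      _ ≤ ENNReal.ofReal (Real.log |r|) :=
        StabilityCondition.dBbar_glAct_le had hg hL.le
      _ ≤ ENNReal.ofReal h := ENNReal.ofReal_le_ofReal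
        (StabilityCondition.le_of_isEntropy hσ hL had hg hne hgen hh)
  · refine (ENNReal.ofReal_pos.2 hL).trans_le (le_iInf₂ fun τ hτ => ?_)
    exact StabilityCondition.le_dBbar hσ hL had hg hne hσS hτ
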